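/- All rings are commutative with identity; "local" means having a unique maximal ideal (no Noetherian assumption). A ring is *coherent* if every finitely generated ideal is finitely presented; *Gaussian* if $c(fg)=c(f)c(g)$ for all polynomials $f,g$ over it, where $c(\cdot)$ is the ideal generated by the coefficients; *arithmetical* if the ideals of each of its localizations at prime ideals are linearly ordered by inclusion. The weak global dimension $\operatorname{w.dim}(R)$ is the supremum of the flat dimensions of all $R$-modules. For an ideal $I$ of a ring $A$, let $A\bowtie I=\{(a,a+i)\mid a\in A,\ i\in I\}\subseteq A\times A$ be the amalgamated duplication, let $0\times I=\{(0,i)\mid i\in I\}$, an ideal of $A\bowtie I$, and, for an $A$-module $E$, let $A\ltimes E$ be the trivial ring extension ($A\oplus E$ with $(a,e)(b,f)=(ab,af+be)$). (1) Let $A$ be a local non-coherent Gaussian ring and $I$ a nonzero proper ideal of $A$ with $I^2=0$ and $aI=a^2I$ for all $a\in A$. Then $(a,a+i)\mapsto(a,i)$ is a ring isomorphism $A\bowtie I\cong A\ltimes I$. If $I$ is finitely generated or $I$ is not flat over $A$, then $0\times I$ is not flat over $A\bowtie I$. Moreover, if $0\times I$ is not flat over $A\bowtie I$, then $R:=A\bowtie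 I\cong A\ltimes I$ is a local, non-arithmetical, non-coherent Gaussian ring with $\operatorname{w.dim}(R)=\infty$. (2) Explicitly, $A:=\mathbb{Z}_{(2)}\ltimes\mathbb{Q}$ and $I:=0\ltimes\mathbb{Q}$ satisfy all these hypotheses: $A$ is a local non-coherent Gaussian ring, $I$ is a nonzero proper ideal with $I^2=0$ and $aI=a^2I$ for all $a\in A$, $I$ is not flat over $A$, and $0\times I$ is not flat over $A\bowtie I$. Hence $A\bowtie I$ is a local, non-arithmetical, non-coherent Gaussian ring with $\operatorname{w.dim}(A\bowtie I)=\infty$. -/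

import Mathlib

universe u

/-- The amalgamated duplication `A ⋈ I = {(a, a + i) ∣ a ∈ A, i ∈ I}` of a ring `A` along an
ideal `I`, as a subring of `A × A`. -/
def amalgDup {A : Type u} [CommRing A] (I : Ideal A) : Subring (A × A) where
  carrier := {x | x.2 - x.1 ∈ I}
  zero_mem' := by simp
  one_mem' := by simp
  add_mem' := by
    intro x y hx hy
    have h : (x + y).2 - (x + y).1 = (x.2 - x.1) + (y.2 - y.1) := by
      simp only [Prod.fst_add, Prod.snd_add]; ring
    simp only [Set.mem_ofPred_eq] at hx hy ⊢
    rw [h]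
    exact I.add_mem hx hy
  neg_mem' := by
    intro x hx
    have h : (-x).2 - (-x).1 = -(x.2 - x.1) := by
      simp only [Prod.fst_neg, Prod.snd_neg]; ring
    simp only [Set.mem_ofPred_eq] at hx ⊢
    rw [h]
    exact I.neg_mem hx
  mul_mem' := by
    intro x y hx hy
    have h : (x * y).2 - (x * y).1 = y.2 * (x.2 - x.1) + x.1 * (y.2 - y.1) := by
      simp only [Prod.fst_mul, Prod.snd_mul]; ring
    simp only [Set.mem_ofPred_eq] at hx hy ⊢
    rw [h]
    exact I.add_mem (I.mul_mem_left _ hx) (I.mul_mem_left _ hy)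

/-- The ideal `0 × I = {(0, i) ∣ i ∈ I}` of `A ⋈ I`. -/
def zeroProd {A : Type u} [CommRing A] (I : Ideal A) : Ideal (amalgDup I) where
  carrier := {x | (x : A × A).1 = 0}
  zero_mem' := by simp
  add_mem' := by
    intro x y hx hy
    simp only [Set.mem_ofPred_eq] at hx hy ⊢
    simp [hx, hy]
  smul_mem' := by
    intro c x hx
    simp only [Set.mem_ofPred_eq] at hx ⊢
    simp [hx]

/-- A ring is coherent if each of its finitely generated ideals is finitely presented. -/
def IsCoherentRing (R : Type u) [CommRing R] : Prop :=
  ∀ J : Ideal R, J.FG → Module.FinitePresentation R J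

/-- A ring is Gaussian if `c(fg) = c(f)c(g)` for all polynomials `f, g` over it, where `c` denotes
the ideal generated by the coefficients. -/
def IsGaussianRing (R : Type u) [CommRing R] : Prop :=
  ∀ f g : Polynomial R, (f * g).contentIdeal = f.contentIdeal * g.contentIdeal

/-- A ring is arithmetical if the ideals of each of its localizations at prime ideals are linearly
ordered by inclusion. -/
def IsArithmeticalRing (R : Type u) [CommRing R] : Prop :=
  ∀ (p : Ideal R) [p.IsPrime] (J K : Ideal (Localization.AtPrime p)), J ≤ K ∨ K ≤ J

/-- `FlatDimLE R n M` says that `M` has a flat resolution `0 → Fₙ → ⋯ → F₀ → M → 0` of length at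
most `n`: for `n = 0`, that `M` is flat, and for `n + 1`, that there is a surjection `F₀ → M` from
a flat module whose kernel has a flat resolution of length at most `n`. -/
def FlatDimLE (R : Type u) [CommRing R] :
    ℕ → ∀ (M : Type u) [AddCommGroup M] [Module R M], Prop
  | 0, M, _, _ => Module.Flat R M
  | n + 1, M, _, _ => ∃ (F : Type u) (_ : AddCommGroup F) (_ : Module R F) (f : F →ₗ[R] M),
      Module.Flat R F ∧ Function.Surjective f ∧ FlatDimLE R n (LinearMap.ker f)

/-- The flat dimension of a module: the least length of a flat resolution, `⊤` if there is no
finite one. -/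
noncomputable def flatDim (R : Type u) [CommRing R] (M : Type u) [AddCommGroup M] [Module R M] :
    ℕ∞ :=
  ⨅ (n : ℕ) (_ : FlatDimLE R n M), (n : ℕ∞)

/-- The weak global dimension of a ring: the supremum of the flat dimensions of its modules. -/
noncomputable def wDim (R : Type u) [CommRing R] : ℕ∞ :=
  ⨆ M : ModuleCat.{u} R, flatDim R M

instance isPrime_span_two : (Ideal.span {(2 : ℤ)}).IsPrime :=
  (Ideal.span_singleton_prime two_ne_zero).2 Int.prime_two

/-- The ring `ℤ₍₂₎`, the localization of `ℤ` at the prime ideal `(2)`, inside `ℚ`. -/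
noncomputable abbrev Z2 : Subalgebra ℤ ℚ :=
  Localization.subalgebra.ofField ℚ (Ideal.span {(2 : ℤ)}).primeCompl
    (Ideal.primeCompl_le_nonZeroDivisors _)

/-- The (only possible) symmetric right action of `ℤ₍₂₎` on `ℚ`. -/
noncomputable instance moduleZ2Op : Module Z2ᵐᵒᵖ ℚ :=
  Module.compHom ℚ ((RingHom.id Z2).fromOpposite fun x y => mul_comm x y)

instance isCentralScalarZ2 : IsCentralScalar Z2 ℚ where
  op_smul_eq_smul _ _ := rfl

/-- The trivial ring extension `ℤ₍₂₎ ⋉ ℚ`. -/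
abbrev Z2Q : Type := TrivSqZeroExt Z2 ℚ

/-- The ideal `0 ⋉ ℚ` of `ℤ₍₂₎ ⋉ ℚ`. -/
noncomputable abbrev zeroQ : Ideal Z2Q := TrivSqZeroExt.kerIdeal Z2 ℚ

/-! A local Gaussian ring is recognised by pairs of elements (`IsSqTotal`): (a, b)² is generated by
a² or by b², and if ab = 0 with a² dividing b², then b² = 0. Such pairs have the form b = ra + n
with an = n² = 0. When aM = a²M for all a, nilpotents n with n² = 0 kill M, so the criterion lifts
from A to A ⋉ M; this makes A ⋈ I Gaussian. Coherence would descend along the retraction A ⋈ I → A,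
and (0, i), (i, i) are incomparable under divisibility.

Write R = A ⋈ I and E = 0 × I. Modulo Ann(I), divisibility in A is total. Infinite weak dimension
splits into two cases. If c²i = 0 always forces ci = 0 on I, then P = Ann(y) is prime for 0 ≠ y ∈ I.
With p the preimage of P in R, (0, y) has square zero and is nonzero in (p/p²)_p; a nonzero class in
a fibre at p that is killed by (0, y) then passes to every syzygy
(`Ideal.wDim_eq_top_of_sq_eq_zero`). Otherwise c²i = 0 ≠ ci for some c and i. Now Ann(I) is prime,
its preimage J has a valuation domain as quotient, E is a retract of J killed by J, and cI = c²I
lets ci be divided by c forever inside E. This tower turns c-power torsion in X/JX into torsion in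
the second syzygy, losing one power of c (`TorsionTower.hasTorsion_ker_ker`); E starts with
arbitrarily long torsion. -/

/-! ### Local Gaussian rings and their trivial extensions. -/

section Gaussian

open Polynomial

variable {R : Type u} [CommRing R]

/-- The Gaussian property is only ever used for products of two linear polynomials (aX + b)(cX + d).
-/
theorem IsGaussianRing.mul_mem_span (h : IsGaussianRing R) (a b c d : R) :
    a * d ∈ Ideal.span {a * c, a * d + b * c, b * d} := by
  have hle : ((C a * X + C b) * (C c * X + C d) : R[X]).contentIdeal ≤
      Ideal.span {a * c, a * d + b * c, b * d} := by
    have hp : ((C a * X + C b) * (C c * X + C d) : R[X]) =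
        C (a * c) * X ^ 2 + C (a * d + b * c) * X + C (b * d) := by
      simp only [map_mul, map_add]; ring
    rw [hp, contentIdeal_def, Ideal.span_le]
    intro x hx
    obtain ⟨n, -, rfl⟩ := mem_coeffs_iff.1 hx
    rcases n with _ | _ | _ | n
    · exact Ideal.subset_span (by simp)
    · refine Ideal.subset_span ?_
      simp only [coeff_add, coeff_C_mul, coeff_X_pow, coeff_X, coeff_C]
      simp
    · refine Ideal.subset_span ?_
      simp only [coeff_add, coeff_C_mul, coeff_X_pow, coeff_X, coeff_C]
      simp
    · simp only [coeff_add, coeff_C_mul, coeff_X_pow, coeff_X, coeff_C]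
      simp
  apply hle
  rw [h]
  refine Ideal.mul_mem_mul ?_ ?_
  · have := coeff_mem_contentIdeal (C a * X + C b : R[X]) 1
    simpa only [coeff_add, coeff_C_mul, coeff_X_one, coeff_C_succ, mul_one, add_zero] using this
  · have := coeff_mem_contentIdeal (C c * X + C d : R[X]) 0
    simpa only [coeff_add, coeff_C_mul, coeff_X_zero, coeff_C_zero, mul_zero, zero_add] using this

theorem IsGaussianRing.exists_mul_eq (h : IsGaussianRing R) (a b c d : R) :
    ∃ x y z : R, a * d = x * (a * c) + y * (a * d + b * c) + z * (b * d) := by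
  obtain ⟨x, w, hw, h1⟩ := Ideal.mem_span_insert.1 (h.mul_mem_span a b c d)
  obtain ⟨y, z, h2⟩ := Ideal.mem_span_pair.1 hw
  exact ⟨x, y, z, by linear_combination h1 - h2⟩

/-- `a` precedes `b` if the square of the ideal `(a, b)` is generated by `a ^ 2`. -/
def SqPrec (a b : R) : Prop := a ^ 2 ∣ a * b ∧ a ^ 2 ∣ b ^ 2

/-- The condition on pairs of elements that characterizes the Gaussian rings among the local
rings. -/
structure IsSqTotal (R : Type u) [CommRing R] : Prop where
  total : ∀ a b : R, SqPrec a b ∨ SqPrec b a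
  sq_eq_zero : ∀ a b : R, a * b = 0 → a ^ 2 ∣ b ^ 2 → b ^ 2 = 0

theorem IsGaussianRing.sqPrec_of_isUnit [IsLocalRing R] (h : IsGaussianRing R) {a b r s : R}
    (hab : a * b = r * a ^ 2 + s * b ^ 2) (hr : IsUnit r) : SqPrec b a := by
  -- The middle coefficient is ra² + sb² = ab, so all three coefficients are multiples of ab.
  obtain ⟨x, y, z, hxyz⟩ := h.exists_mul_eq a (s * b) b (r * a)
  have hra : r * a ^ 2 = (x + y + z * (r * s)) * (a * b) := by
    linear_combination hxyz - y * hab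
  obtain ⟨r', hr'⟩ := hr.exists_left_inv
  obtain ⟨k, hk⟩ : ∃ k, a ^ 2 = k * (a * b) :=
    ⟨r' * (x + y + z * (r * s)), by linear_combination r' * hra - a ^ 2 * hr'⟩
  by_cases hu : IsUnit k
  · obtain ⟨k', hk'⟩ := hu.exists_left_inv
    -- Since a(a - kb) = 0, only the middle coefficient a² + (a - kb)² = k²b² survives.
    obtain ⟨x, y, z, hq⟩ := h.exists_mul_eq a (a - k * b) (a - k * b) a
    have h1 : a ^ 2 = y * k ^ 2 * b ^ 2 := by
      linear_combination hq + (x + z + y * 2) * hk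
    refine ⟨⟨k' * y * k ^ 2, ?_⟩, ⟨y * k ^ 2, by linear_combination h1⟩⟩
    linear_combination k' * h1 - a * b * hk' - k' * hk
  · have h1 : IsUnit (1 - r * k) := by
      by_contra hn
      exact IsLocalRing.nonunits_add hn
        (show r * k ∈ nonunits R from fun h' => hu (isUnit_of_mul_isUnit_right h')) (by simp)
    obtain ⟨t, ht⟩ := h1.exists_left_inv
    have h2 : a * b = t * s * b ^ 2 := by
      linear_combination t * hab - a * b * ht + t * r * hk
    exact ⟨⟨t * s, by linear_combination h2⟩, ⟨k * (t * s), by linear_combination hk + k * h2⟩⟩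

theorem IsGaussianRing.isSqTotal [IsLocalRing R] (h : IsGaussianRing R) : IsSqTotal R where
  total a b := by
    -- Here (aX + b)(aX - b) = a²X² - b², so ab lies in (a², b²).
    obtain ⟨x, y, z, h1⟩ := h.exists_mul_eq a b a (-b)
    obtain ⟨r, s, hab⟩ : ∃ r s, a * b = r * a ^ 2 + s * b ^ 2 :=
      ⟨-x, z, by linear_combination -h1⟩
    by_cases hr : IsUnit r
    · exact .inr (h.sqPrec_of_isUnit hab hr)
    by_cases hs : IsUnit s
    · exact .inl (h.sqPrec_of_isUnit (a := b) (b := a) (r := s) (s := r)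
        (by linear_combination hab) hs)
    -- With r and s both nonunits, this second relation puts ab, a² and b² all in (a² + b²). Then a²
    -- = p(a² + b²) and b² = (1 - p)(a² + b²), and one of p, 1 - p is a unit.
    obtain ⟨x, v, z, h2⟩ := h.exists_mul_eq a b b a
    have hunit : IsUnit (1 - (r - s) * (x + z)) := by
      by_contra hn
      have h3 : r - s ∈ nonunits R := by
        rw [sub_eq_add_neg]
        exact IsLocalRing.nonunits_add hr (fun h' => hs (by simpa using h'.neg))
      exact IsLocalRing.nonunits_add hn
        (show (r - s) * (x + z) ∈ nonunits R from fun h' => h3 (isUnit_of_mul_isUnit_left h'))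
        (by simp)
    obtain ⟨t, ht⟩ := hunit.exists_left_inv
    have hw : a * b = t * (r * v + s * (1 - v)) * (a ^ 2 + b ^ 2) := by
      linear_combination t * hab + t * (r - s) * h2 - a * b * ht
    generalize t * (r * v + s * (1 - v)) = w at hw
    have hp : a ^ 2 = ((x + z) * w + v) * (a ^ 2 + b ^ 2) := by
      linear_combination h2 + (x + z) * hw
    generalize (x + z) * w + v = p at hp
    have hq : b ^ 2 = (1 - p) * (a ^ 2 + b ^ 2) := by linear_combination -hp
    rcases IsLocalRing.isUnit_or_isUnit_one_sub_self p with hu | hu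
    · obtain ⟨p', hp'⟩ := hu.exists_left_inv
      have h3 : a ^ 2 + b ^ 2 = p' * a ^ 2 := by
        linear_combination -p' * hp - (a ^ 2 + b ^ 2) * hp'
      exact .inl ⟨⟨w * p', by linear_combination hw + w * h3⟩,
        ⟨(1 - p) * p', by linear_combination hq + (1 - p) * h3⟩⟩
    · obtain ⟨p', hp'⟩ := hu.exists_left_inv
      have h3 : a ^ 2 + b ^ 2 = p' * b ^ 2 := by
        linear_combination -p' * hq - (a ^ 2 + b ^ 2) * hp'
      exact .inr ⟨⟨w * p', by linear_combination hw + w * h3⟩,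
        ⟨p * p', by linear_combination hp + p * h3⟩⟩
  sq_eq_zero a b hab := by
    rintro ⟨k, hk⟩
    -- The middle coefficient b² - ka² vanishes, and the outer ones are multiples of ab = 0.
    obtain ⟨x, y, z, h1⟩ := h.exists_mul_eq a b b (-(k * a))
    linear_combination hk + (-1) * h1 + (z * k - x) * hab - y * hk

namespace IsSqTotal

theorem mul_eq_zero_of_sq (h : IsSqTotal R) {m n : R} (hm : m ^ 2 = 0) (hn : n ^ 2 = 0) :
    m * n = 0 := by
  rcases h.total m n with h1 | h1
  · exact zero_dvd_iff.1 (hm ▸ h1.1)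
  · rw [mul_comm]; exact zero_dvd_iff.1 (hn ▸ h1.1)

theorem exists_eq_mul_add (h : IsSqTotal R) {a b : R} (hab : SqPrec a b) :
    ∃ r n, b = r * a + n ∧ a * n = 0 ∧ n ^ 2 = 0 := by
  obtain ⟨⟨r, hr⟩, ⟨s, hs⟩⟩ := hab
  have h0 : a * (b - r * a) = 0 := by linear_combination hr
  refine ⟨r, b - r * a, by ring, h0, h.sq_eq_zero a _ h0 ⟨s - r ^ 2, ?_⟩⟩
  linear_combination hs - 2 * r * hr

theorem exists_sqPrec_forall (h : IsSqTotal R) (s : Finset R) (hs : s.Nonempty) :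
    ∃ d ∈ s, ∀ x ∈ s, SqPrec d x := by
  classical
  induction hs using Finset.Nonempty.cons_induction with
  | singleton a => exact ⟨a, by simp, fun x hx => by
      rw [Finset.mem_singleton.1 hx]; exact ⟨by rw [sq], dvd_rfl⟩⟩
  | cons e s he hs ih =>
    obtain ⟨d, hd, hmin⟩ := ih
    by_cases hde : SqPrec d e
    · refine ⟨d, by simp [hd], fun x hx => ?_⟩
      rcases Finset.mem_cons.1 hx with rfl | hx
      · exact hde
      · exact hmin x hx
    have hed := (h.total d e).resolve_left hde
    refine ⟨e, by simp, fun x hx => ?_⟩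
    rcases Finset.mem_cons.1 hx with rfl | hx
    · exact ⟨by rw [sq], dvd_rfl⟩
    have h1 : e ^ 2 ∣ x ^ 2 := hed.2.trans (hmin x hx).2
    rcases h.total e x with h2 | h2
    · exact h2
    · exact ⟨h1.trans (by simpa [mul_comm] using h2.1), h1⟩

end IsSqTotal

theorem Polynomial.exists_coeff_eq_ite (v : ℕ → R) (N : ℕ) :
    ∃ p : R[X], ∀ n, p.coeff n = if n < N then v n else 0 :=
  ⟨∑ i ∈ Finset.range N, monomial i (v i), fun n => by
    simp [coeff_monomial]⟩

/-- McCoy's theorem over R/c(pq): a polynomial of unit content stays a non-zero-divisor there, so pq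
= 0 gives q = 0. -/
theorem Polynomial.contentIdeal_le_mul_of_eq_top {p : R[X]} (hp : p.contentIdeal = ⊤) (q : R[X]) :
    q.contentIdeal ≤ (p * q).contentIdeal := by
  set K := (p * q).contentIdeal with hK
  have h0 : p.map (Ideal.Quotient.mk K) * q.map (Ideal.Quotient.mk K) = 0 := by
    rw [← Polynomial.map_mul]
    ext n
    rw [coeff_map, coeff_zero, Ideal.Quotient.eq_zero_iff_mem]
    exact coeff_mem_contentIdeal _ n
  have hreg : p.map (Ideal.Quotient.mk K) ∈ nonZeroDivisors (R ⧸ K)[X] := by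
    by_contra hn
    obtain ⟨a, ha, hap⟩ := Polynomial.notMem_nonZeroDivisors_iff.1 hn
    apply ha
    obtain ⟨a, rfl⟩ := Ideal.Quotient.mk_surjective a
    have hle : p.contentIdeal ≤ Submodule.comap (LinearMap.mulLeft R a) K := by
      rw [contentIdeal_def, Ideal.span_le]
      intro x hx
      obtain ⟨n, -, rfl⟩ := mem_coeffs_iff.1 hx
      have := congrArg (fun f => coeff f n) hap
      simp only [coeff_smul, coeff_map, smul_eq_mul, ← map_mul, coeff_zero] at this
      exact (Ideal.Quotient.eq_zero_iff_mem (I := K)).1 this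
    have h1 : (1 : R) ∈ Submodule.comap (LinearMap.mulLeft R a) K := hle (hp ▸ Submodule.mem_top)
    exact Ideal.Quotient.eq_zero_iff_mem.2 (by simpa using h1)
  have hq : q.map (Ideal.Quotient.mk K) = 0 :=
    (mul_left_mem_nonZeroDivisors_eq_zero_iff hreg).1 h0
  rw [contentIdeal_def, Ideal.span_le]
  intro x hx
  obtain ⟨n, -, rfl⟩ := mem_coeffs_iff.1 hx
  have := congrArg (fun f => coeff f n) hq
  simp only [coeff_map, coeff_zero] at this
  exact Ideal.Quotient.eq_zero_iff_mem.1 this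

/-- Write f = dr + m and g = ds + m', where the coefficients of m and m' are killed by d and have
pairwise product zero. Then fg = d²rs and each product of coefficients is d² times one of r and one
of s. As r has unit content, c(rs) contains c(s). -/
theorem IsSqTotal.contentIdeal_mul_le (h : IsSqTotal R) {f g : R[X]} {d : R}
    (hd : d ∈ f.coeffs) (hf : ∀ x ∈ f.coeffs, SqPrec d x) (hg : ∀ x ∈ g.coeffs, SqPrec d x) :
    f.contentIdeal * g.contentIdeal ≤ (f * g).contentIdeal := by
  classical
  -- The clause forcing r = 1 at coefficients equal to d is what gives the quotient of f unit
  -- content.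
  have key : ∀ p : R[X], (∀ x ∈ p.coeffs, SqPrec d x) → ∀ n, ∃ r m,
      p.coeff n = r * d + m ∧ d * m = 0 ∧ m ^ 2 = 0 ∧ (p.coeff n = d → r = 1) := by
    intro p hp n
    by_cases hpn : p.coeff n = d
    · exact ⟨1, 0, by simp [hpn], by simp, by simp, fun _ => rfl⟩
    have h1 : SqPrec d (p.coeff n) := by
      by_cases h0 : p.coeff n = 0
      · rw [h0]; exact ⟨by simp, by simp⟩
      · exact hp _ (mem_coeffs_iff.2 ⟨n, mem_support_iff.2 h0, rfl⟩)
    obtain ⟨r, m, h2, h3, h4⟩ := h.exists_eq_mul_add h1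
    exact ⟨r, m, h2, h3, h4, fun h' => absurd h' hpn⟩
  have key2 : ∀ p : R[X], (∀ x ∈ p.coeffs, SqPrec d x) → ∃ r m : R[X], p = C d * r + m ∧
      (∀ n, d * m.coeff n = 0) ∧ (∀ n, m.coeff n ^ 2 = 0) ∧
      (∀ n ∈ p.support, p.coeff n = d → r.coeff n = 1) := by
    intro p hp
    choose r m h1 h2 h3 h4 using key p hp
    obtain ⟨r', hr'⟩ := exists_coeff_eq_ite r (p.natDegree + 1)
    obtain ⟨m', hm'⟩ := exists_coeff_eq_ite m (p.natDegree + 1)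
    refine ⟨r', m', ?_, ?_, ?_, ?_⟩
    · ext n
      rw [coeff_add, coeff_C_mul, hr', hm']
      split_ifs with hn
      · rw [h1, mul_comm]
      · rw [coeff_eq_zero_of_natDegree_lt (by omega)]; simp
    · intro n; rw [hm']; split_ifs <;> simp [h2]
    · intro n; rw [hm']; split_ifs <;> simp [h3]
    · intro n hn hpn
      rw [hr', if_pos (Nat.lt_succ_of_le (le_natDegree_of_mem_supp n hn)), h4 n hpn]
  obtain ⟨r, m, hfe, hm, hm2, hr⟩ := key2 f hf
  obtain ⟨s, m', hge, hm', hm2', -⟩ := key2 g hg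
  obtain ⟨n₀, hn₀, hdn⟩ := mem_coeffs_iff.1 hd
  have hrtop : r.contentIdeal = ⊤ := by
    rw [Ideal.eq_top_iff_one, ← hr n₀ hn₀ hdn.symm]
    exact coeff_mem_contentIdeal r n₀
  have hCm : C d * m = 0 := by ext n; simp [hm]
  have hCm' : C d * m' = 0 := by ext n; simp [hm']
  have hmm : m * m' = 0 := by
    ext n
    rw [coeff_mul, coeff_zero]
    exact Finset.sum_eq_zero fun x _ => h.mul_eq_zero_of_sq (hm2 _) (hm2' _)
  have hfg : f * g = C (d ^ 2) * (r * s) := by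
    rw [hfe, hge, C_pow]
    linear_combination r * hCm' + s * hCm + hmm
  have hmul : (r * s).contentIdeal ≤
      Submodule.comap (LinearMap.mulLeft R (d ^ 2)) (f * g).contentIdeal := by
    rw [contentIdeal_def, Ideal.span_le]
    intro x hx
    obtain ⟨n, -, rfl⟩ := mem_coeffs_iff.1 hx
    have := coeff_mem_contentIdeal (f * g) n
    rw [hfg, coeff_C_mul, ← hfg] at this
    exact this
  rw [contentIdeal_def f, contentIdeal_def g, Ideal.span_mul_span', Ideal.span_le]
  rintro _ ⟨x, hx, y, hy, rfl⟩
  obtain ⟨i, -, rfl⟩ := mem_coeffs_iff.1 hx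
  obtain ⟨j, -, rfl⟩ := mem_coeffs_iff.1 hy
  have h1 : d ^ 2 * s.coeff j ∈ (f * g).contentIdeal :=
    hmul (contentIdeal_le_mul_of_eq_top hrtop s (coeff_mem_contentIdeal s j))
  have h2 : f.coeff i * g.coeff j = r.coeff i * (d ^ 2 * s.coeff j) := by
    have hi : f.coeff i = d * r.coeff i + m.coeff i := by
      conv_lhs => rw [hfe]
      simp
    have hj : g.coeff j = d * s.coeff j + m'.coeff j := by
      conv_lhs => rw [hge]
      simp
    rw [hi, hj]
    linear_combination r.coeff i * hm' j + s.coeff j * hm i +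
      h.mul_eq_zero_of_sq (hm2 i) (hm2' j)
  simp only [SetLike.mem_coe]
  rw [h2]
  exact Ideal.mul_mem_left _ _ h1

theorem IsSqTotal.isGaussianRing (h : IsSqTotal R) : IsGaussianRing R := by
  classical
  intro f g
  refine le_antisymm (contentIdeal_mul_le_mul_contentIdeal f g) ?_
  by_cases hf : f = 0
  · simp [hf]
  have hne : f.coeffs.Nonempty := by
    obtain ⟨n, hn⟩ := support_nonempty.2 hf
    exact ⟨_, mem_coeffs_iff.2 ⟨n, hn, rfl⟩⟩
  obtain ⟨d, hd, hmin⟩ := h.exists_sqPrec_forall (f.coeffs ∪ g.coeffs) (hne.inl)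
  rcases Finset.mem_union.1 hd with hd | hd
  · exact h.contentIdeal_mul_le hd (fun x hx => hmin x (Finset.mem_union_left _ hx))
      (fun x hx => hmin x (Finset.mem_union_right _ hx))
  · rw [mul_comm, mul_comm f]
    exact h.contentIdeal_mul_le hd (fun x hx => hmin x (Finset.mem_union_right _ hx))
      (fun x hx => hmin x (Finset.mem_union_left _ hx))

theorem IsSqTotal.of_ringEquiv {S : Type u} [CommRing S] (h : IsSqTotal R) (e : S ≃+* R) :
    IsSqTotal S where
  total a b := by
    have := h.total (e a) (e b)
    simp only [SqPrec, ← map_mul, ← map_pow, map_dvd_iff] at this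
    exact this
  sq_eq_zero a b hab hd := by
    have := h.sq_eq_zero (e a) (e b) (by rw [← map_mul, hab, map_zero])
      (by rw [← map_pow, ← map_pow]; exact map_dvd e hd)
    rw [← map_pow] at this
    exact (map_eq_zero_iff e e.injective).1 this

theorem IsSqTotal.trivSqZeroExt {M : Type u} [AddCommGroup M] [Module R M] [Module Rᵐᵒᵖ M]
    [IsCentralScalar R M] (h : IsSqTotal R) (hM : ∀ (a : R) (m : M), ∃ m', a • m = a ^ 2 • m') :
    IsSqTotal (TrivSqZeroExt R M) := by
  have hsq : ∀ (n : R) (m : M), n ^ 2 = 0 → n • m = 0 := fun n m hn => by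
    obtain ⟨m', hm'⟩ := hM n m
    rw [hm', hn, zero_smul]
  have key : ∀ x y : TrivSqZeroExt R M, SqPrec x.fst y.fst → SqPrec x y := by
    intro x y hxy
    obtain ⟨e, n, hb, han, hn⟩ := h.exists_eq_mul_add hxy
    -- The quotients of xy and y² by x² have first components e and e²; k and l absorb the remaining
    -- M-components, which are multiples of `x.fst` and hence of its square.
    obtain ⟨k, hk⟩ := hM x.fst (y.snd - e • x.snd)
    obtain ⟨l, hl⟩ := hM x.fst ((2 * e) • y.snd - (2 * e ^ 2) • x.snd)
    refine ⟨⟨TrivSqZeroExt.inl e + TrivSqZeroExt.inr k, ?_⟩,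
      ⟨TrivSqZeroExt.inl (e ^ 2) + TrivSqZeroExt.inr l, ?_⟩⟩
    · ext
      · simp only [TrivSqZeroExt.fst_mul, TrivSqZeroExt.fst_pow, TrivSqZeroExt.fst_add,
          TrivSqZeroExt.fst_inl, TrivSqZeroExt.fst_inr, hb]
        linear_combination han
      · simp only [sq, TrivSqZeroExt.snd_mul, TrivSqZeroExt.fst_mul, TrivSqZeroExt.snd_add,
          TrivSqZeroExt.fst_add, TrivSqZeroExt.fst_inl, TrivSqZeroExt.fst_inr,
          TrivSqZeroExt.snd_inl, TrivSqZeroExt.snd_inr, op_smul_eq_smul, hb] at hk ⊢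
        have := hsq n x.snd hn
        simp only [add_smul, zero_add, add_zero, smul_add, this, ← hk]
        module
    · ext
      · simp only [TrivSqZeroExt.fst_mul, TrivSqZeroExt.fst_pow, TrivSqZeroExt.fst_add,
          TrivSqZeroExt.fst_inl, TrivSqZeroExt.fst_inr, hb]
        linear_combination 2 * e * han + hn
      · simp only [sq, TrivSqZeroExt.snd_mul, TrivSqZeroExt.fst_mul, TrivSqZeroExt.snd_add,
          TrivSqZeroExt.fst_add, TrivSqZeroExt.fst_inl, TrivSqZeroExt.fst_inr,
          TrivSqZeroExt.snd_inl, TrivSqZeroExt.snd_inr, op_smul_eq_smul, hb] at hl ⊢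
        have := hsq n y.snd hn
        simp only [add_smul, zero_add, add_zero, smul_add, this, ← hl]
        module
  refine ⟨fun x y => (h.total x.fst y.fst).imp (key x y) (key y x), fun x y hxy hd => ?_⟩
  have h1 : y.fst ^ 2 = 0 := by
    refine h.sq_eq_zero x.fst y.fst (by rw [← TrivSqZeroExt.fst_mul, hxy, TrivSqZeroExt.fst_zero])
      ?_
    obtain ⟨k, hk⟩ := hd
    exact ⟨k.fst, by rw [← TrivSqZeroExt.fst_pow, hk]; simp⟩
  ext
  · simpa using h1
  · have := hsq _ y.snd h1
    simp [sq, TrivSqZeroExt.snd_mul, this]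

end Gaussian

/-! ### Flat dimension and the tensor form of flatness. -/

section FlatDimension

open TensorProduct

variable {R : Type u} [CommRing R]

theorem FlatDimLE.succ {n : ℕ} {M : Type u} [AddCommGroup M] [Module R M]
    (h : FlatDimLE R n M) : FlatDimLE R (n + 1) M := by
  induction n generalizing M with
  | zero =>
    refine ⟨M, _, _, LinearMap.id, h, Function.surjective_id, ?_⟩
    have : Subsingleton (LinearMap.ker (LinearMap.id : M →ₗ[R] M)) := by
      rw [LinearMap.ker_id]; infer_instance
    exact (inferInstance : Module.Flat R (LinearMap.ker (LinearMap.id : M →ₗ[R] M)))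
  | succ n ih =>
    obtain ⟨F, _, _, f, hF, hf, h⟩ := h
    exact ⟨F, _, _, f, hF, hf, ih h⟩

theorem FlatDimLE.mono {m n : ℕ} (hmn : m ≤ n) {M : Type u} [AddCommGroup M] [Module R M]
    (h : FlatDimLE R m M) : FlatDimLE R n M := by
  induction n, hmn using Nat.le_induction with
  | base => exact h
  | succ n _ ih => exact ih.succ

theorem wDim_eq_top_of_forall_not_flatDimLE (M : Type u) [AddCommGroup M] [Module R M]
    (h : ∀ n, ¬ FlatDimLE R n M) : wDim R = ⊤ := by
  have h1 : flatDim R M = ⊤ := by simp [flatDim, h]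
  exact top_le_iff.1 (h1.symm.le.trans (le_iSup (fun M : ModuleCat.{u} R => flatDim R M)
    (ModuleCat.of R M)))

/-- The multiplication map `I ⊗ M → M`. -/
noncomputable def Ideal.tensorSMul (I : Ideal R) (M : Type u) [AddCommGroup M] [Module R M] :
    I ⊗[R] M →ₗ[R] M :=
  (TensorProduct.lid R M).toLinearMap ∘ₗ LinearMap.rTensor M (Submodule.subtype I)

@[simp]
theorem Ideal.tensorSMul_tmul (I : Ideal R) {M : Type u} [AddCommGroup M] [Module R M]
    (a : I) (m : M) : I.tensorSMul M (a ⊗ₜ m) = (a : R) • m := by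
  simp [Ideal.tensorSMul]

theorem Ideal.tensorSMul_injective (I : Ideal R) (M : Type u) [AddCommGroup M] [Module R M]
    [Module.Flat R M] : Function.Injective (I.tensorSMul M) :=
  (TensorProduct.lid R M).injective.comp
    (Module.Flat.rTensor_preserves_injective_linearMap _ (Submodule.injective_subtype I))

theorem Ideal.tensorSMul_lTensor (I : Ideal R) {M N : Type u} [AddCommGroup M] [Module R M]
    [AddCommGroup N] [Module R N] (g : M →ₗ[R] N) (t : I ⊗[R] M) :
    I.tensorSMul N (LinearMap.lTensor I g t) = g (I.tensorSMul M t) := by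
  induction t with
  | zero => simp
  | tmul a m => simp
  | add x y hx hy => simp only [map_add, hx, hy]

theorem Ideal.exists_tensorSMul_eq (I : Ideal R) {M : Type u} [AddCommGroup M] [Module R M]
    {x : M} (hx : x ∈ (I • ⊤ : Submodule R M)) : ∃ t, I.tensorSMul M t = x := by
  induction hx using Submodule.smul_induction_on' with
  | smul a ha m _ => exact ⟨⟨a, ha⟩ ⊗ₜ m, by simp⟩
  | add x _ y _ hx hy =>
    obtain ⟨s, rfl⟩ := hx
    obtain ⟨t, rfl⟩ := hy
    exact ⟨s + t, map_add _ _ _⟩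

/-- Tensor the exact sequence Ann(y) → R → R, the last map being multiplication by y, with X. -/
theorem Module.Flat.mem_ker_mulRight_smul_top {X : Type u} [AddCommGroup X] [Module R X]
    [Module.Flat R X] {y : R} {ξ : X} (hξ : y • ξ = 0) :
    ξ ∈ (LinearMap.ker (LinearMap.mulRight R y) • ⊤ : Submodule R X) := by
  have hex := Module.Flat.rTensor_exact X
    (LinearMap.exact_subtype_ker_map (LinearMap.mulRight R y))
  obtain ⟨t, ht⟩ := (hex ((1 : R) ⊗ₜ ξ)).1 (by
    simp only [LinearMap.rTensor_tmul, LinearMap.mulRight_apply, one_mul]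
    rw [← mul_one y, ← smul_eq_mul, TensorProduct.smul_tmul, hξ, tmul_zero])
  have h : Ideal.tensorSMul (LinearMap.ker (LinearMap.mulRight R y)) X t = ξ := by
    rw [Ideal.tensorSMul, LinearMap.comp_apply, ht, LinearEquiv.coe_coe, lid_tmul, one_smul]
  rw [← h]
  clear h ht hξ
  induction t with
  | zero => simp
  | tmul a x =>
    rw [Ideal.tensorSMul_tmul]
    exact Submodule.smul_mem_smul a.2 trivial
  | add x y hx hy => rw [map_add]; exact add_mem hx hy

end FlatDimension

/-! ### Infinite weak dimension from a square-zero element outside p² locally at p. -/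

section SquareZeroElement

open TensorProduct

variable {R : Type u} [CommRing R]

/-- The hypothesis says that m is nonzero in the fibre of M at p, a vector space over Frac(R/p), and
linear functionals separate its points. -/
theorem Ideal.exists_linearMap_fractionRing (p : Ideal R) [p.IsPrime] {M : Type u}
    [AddCommGroup M] [Module R M] {m : M}
    (h : ∀ s ∉ p, s • m ∉ (p • ⊤ : Submodule R M)) :
    ∃ φ : M →ₗ[R] FractionRing (R ⧸ p), φ m ≠ 0 := by
  let N := M ⧸ (p • ⊤ : Submodule R M)
  let S := nonZeroDivisors (R ⧸ p)
  let v : LocalizedModule S N := LocalizedModule.mkLinearMap S N (Submodule.Quotient.mk m)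
  have hv : v ≠ 0 := by
    intro h0
    obtain ⟨⟨s, hs⟩, hsm⟩ :=
      (IsLocalizedModule.eq_zero_iff S (LocalizedModule.mkLinearMap S N)).1 h0
    obtain ⟨s, rfl⟩ := Ideal.Quotient.mk_surjective s
    refine h s (fun hsp => nonZeroDivisors.ne_zero hs (Ideal.Quotient.eq_zero_iff_mem.2 hsp)) ?_
    exact (Submodule.Quotient.mk_eq_zero _).1 hsm
  obtain ⟨ψ, hψ⟩ : ∃ ψ : Module.Dual (FractionRing (R ⧸ p)) (LocalizedModule S N), ψ v ≠ 0 := by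
    by_contra! hn
    exact hv ((Module.forall_dual_apply_eq_zero_iff (FractionRing (R ⧸ p)) v).1 hn)
  let χ : N →ₗ[R ⧸ p] FractionRing (R ⧸ p) :=
    (ψ.restrictScalars (R ⧸ p)) ∘ₗ LocalizedModule.mkLinearMap S N
  exact ⟨χ.restrictScalars R ∘ₗ Submodule.mkQ _, hψ⟩

/-- The dimension shift: if x lifts ξ, then η = yx works. Were s·yx in pK for the kernel K and some
s ∉ p, flatness of F would place sy ⊗ x in the image of p ⊗ K, which μ ⊗ φf kills, although
s·μ(y)·φ(ξ) ≠ 0. -/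
theorem Ideal.exists_linearMap_ker (p : Ideal R) [p.IsPrime] {y : R} (hy : y ∈ p)
    (hyy : y * y = 0) (hp : ∀ s ∉ p, s * y ∉ p * p) {X F : Type u} [AddCommGroup X] [Module R X]
    [AddCommGroup F] [Module R F] [Module.Flat R F] {f : F →ₗ[R] X} (hf : Function.Surjective f)
    {ξ : X} {φ : X →ₗ[R] FractionRing (R ⧸ p)} (hφ : φ ξ ≠ 0) (hξ : y • ξ = 0) :
    ∃ (η : LinearMap.ker f) (ψ : LinearMap.ker f →ₗ[R] FractionRing (R ⧸ p)),
      ψ η ≠ 0 ∧ y • η = 0 := by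
  obtain ⟨μ, hμ⟩ : ∃ μ : p →ₗ[R] FractionRing (R ⧸ p), μ ⟨y, hy⟩ ≠ 0 := by
    refine p.exists_linearMap_fractionRing fun s hs hmem => hp s hs ?_
    have := Submodule.mem_map_of_mem (f := Submodule.subtype p) hmem
    rwa [Submodule.map_smul'', Submodule.map_top, Submodule.range_subtype] at this
  obtain ⟨x, rfl⟩ := hf ξ
  have hker : y • x ∈ LinearMap.ker f := by simpa using hξ
  obtain ⟨ψ, hψ⟩ : ∃ ψ : LinearMap.ker f →ₗ[R] FractionRing (R ⧸ p), ψ ⟨y • x, hker⟩ ≠ 0 := by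
    refine p.exists_linearMap_fractionRing fun s hs hmem => ?_
    obtain ⟨t, ht⟩ := p.exists_tensorSMul_eq hmem
    have h1 : LinearMap.lTensor p (LinearMap.ker f).subtype t = (s • ⟨y, hy⟩ : p) ⊗ₜ x := by
      apply p.tensorSMul_injective F
      rw [p.tensorSMul_lTensor, ht]
      simp [smul_smul]
    let B : p ⊗[R] F →ₗ[R] FractionRing (R ⧸ p) :=
      TensorProduct.lift ((LinearMap.mul R (FractionRing (R ⧸ p))).compl₁₂ μ (φ ∘ₗ f))
    have h2 : B ∘ₗ LinearMap.lTensor p (LinearMap.ker f).subtype = 0 := by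
      ext a k
      simp [B]
    have h3 : B ((s • ⟨y, hy⟩ : p) ⊗ₜ x) = 0 := by
      rw [← h1]; exact LinearMap.congr_fun h2 t
    have h4 : s • (μ ⟨y, hy⟩ * φ (f x)) = 0 := by
      rw [← smul_mul_assoc, ← map_smul]; exact h3
    rw [Algebra.smul_def, mul_eq_zero, or_iff_left (mul_ne_zero hμ hφ),
      IsScalarTower.algebraMap_apply R (R ⧸ p) (FractionRing (R ⧸ p)),
      map_eq_zero_iff _ (IsFractionRing.injective (R ⧸ p) (FractionRing (R ⧸ p)))] at h4
    exact hs (Ideal.Quotient.eq_zero_iff_mem.1 h4)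
  exact ⟨_, ψ, hψ, by ext; simp [smul_smul, hyy]⟩

theorem Ideal.not_flatDimLE_of_linearMap (p : Ideal R) [p.IsPrime] {y : R} (hy : y ∈ p)
    (hyy : y * y = 0) (hp : ∀ s ∉ p, s * y ∉ p * p) (n : ℕ) (X : Type u) [AddCommGroup X]
    [Module R X] {ξ : X} {φ : X →ₗ[R] FractionRing (R ⧸ p)} (hφ : φ ξ ≠ 0) (hξ : y • ξ = 0) :
    ¬ FlatDimLE R n X := by
  induction n generalizing X with
  | zero =>
    intro hX
    have hX : Module.Flat R X := hX
    have hann : LinearMap.ker (LinearMap.mulRight R y) ≤ p := by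
      intro a ha
      by_contra hn
      exact hp a hn (by rw [show a * y = 0 from LinearMap.mem_ker.1 ha]; exact zero_mem _)
    have hmem : ξ ∈ (p • ⊤ : Submodule R X) :=
      Submodule.smul_mono hann le_rfl (Module.Flat.mem_ker_mulRight_smul_top hξ)
    apply hφ
    clear hφ hξ
    induction hmem using Submodule.smul_induction_on' with
    | smul a ha x _ =>
      rw [map_smul, Algebra.smul_def,
        IsScalarTower.algebraMap_apply R (R ⧸ p) (FractionRing (R ⧸ p)),
        show algebraMap R (R ⧸ p) a = 0 from Ideal.Quotient.eq_zero_iff_mem.2 ha, map_zero,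
        zero_mul]
    | add x _ y _ hx hy => rw [map_add, hx, hy, add_zero]
  | succ n ih =>
    rintro ⟨F, _, _, f, hF, hf, h⟩
    obtain ⟨η, ψ, hψ, hη⟩ := p.exists_linearMap_ker hy hyy hp hf hφ hξ
    exact ih _ hψ hη h

theorem Ideal.wDim_eq_top_of_sq_eq_zero (p : Ideal R) [p.IsPrime] {y : R} (hy : y ∈ p)
    (hyy : y * y = 0) (hp : ∀ s ∉ p, s * y ∉ p * p) : wDim R = ⊤ := by
  refine wDim_eq_top_of_forall_not_flatDimLE (R ⧸ p) fun n =>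
    p.not_flatDimLE_of_linearMap hy hyy hp n (R ⧸ p) (ξ := 1)
      (φ := (Algebra.linearMap (R ⧸ p) (FractionRing (R ⧸ p))).restrictScalars R) (by simp) ?_
  rw [Algebra.smul_def, mul_one]
  exact Ideal.Quotient.eq_zero_iff_mem.2 hy

end SquareZeroElement

/-! ### Infinite weak dimension from a tower of torsion elements. -/

section Tower

open TensorProduct

variable {R : Type u} [CommRing R]

theorem ValuationRing.of_quotient_total {J : Ideal R} [J.IsPrime]
    (hJ : ∀ a b : R, ∃ e, b - e * a ∈ J ∨ a - e * b ∈ J) : ValuationRing (R ⧸ J) := by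
  refine ValuationRing.iff_dvd_total.2 ⟨fun a b => ?_⟩
  obtain ⟨a, rfl⟩ := Ideal.Quotient.mk_surjective a
  obtain ⟨b, rfl⟩ := Ideal.Quotient.mk_surjective b
  obtain ⟨e, he | he⟩ := hJ a b
  · exact .inl ⟨Ideal.Quotient.mk J e, by
      rw [← map_mul, Ideal.Quotient.eq]; simpa [mul_comm] using he⟩
  · exact .inr ⟨Ideal.Quotient.mk J e, by
      rw [← map_mul, Ideal.Quotient.eq]; simpa [mul_comm] using he⟩

theorem Ideal.flat_quotient_smul_top (J : Ideal R) (F : Type u) [AddCommGroup F] [Module R F]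
    [Module.Flat R F] : Module.Flat (R ⧸ J) (F ⧸ (J • ⊤ : Submodule R F)) :=
  Module.Flat.of_linearEquiv (M := (R ⧸ J) ⊗[R] F)
    ((TensorProduct.quotTensorEquivQuotSMul F J).symm.extendScalarsOfSurjective
      Ideal.Quotient.mk_surjective)

theorem Ideal.mem_smul_top_of_smul_mem (J : Ideal R) [J.IsPrime] {F : Type u} [AddCommGroup F]
    [Module R F] [Module.Flat R F] {s : R} (hs : s ∉ J) {x : F}
    (hx : s • x ∈ (J • ⊤ : Submodule R F)) : x ∈ (J • ⊤ : Submodule R F) := by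
  have := J.flat_quotient_smul_top F
  have h0 : Ideal.Quotient.mk J s ≠ 0 := fun h => hs (Ideal.Quotient.eq_zero_iff_mem.1 h)
  have h1 : Ideal.Quotient.mk J s • (Submodule.Quotient.mk x : F ⧸ (J • ⊤ : Submodule R F)) = 0 :=
    (Submodule.Quotient.mk_eq_zero _).2 hx
  exact (Submodule.Quotient.mk_eq_zero _).1
    ((smul_eq_zero.1 h1).resolve_left h0)

/-- With a = Ann(z), V/a embeds in E by 1 ↦ z, so flatness of K gives y ∈ aK. Totality of
divisibility merges a sum from aK into a single term. -/
theorem ValuationRing.mem_annihilator_smul_of_tmul_eq_zero {V : Type u} [CommRing V] [IsDomain V]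
    [ValuationRing V] {E K : Type u} [AddCommGroup E] [Module V E] [AddCommGroup K] [Module V K]
    [Module.Flat V K] {z : E} {y : K} (h : z ⊗ₜ[V] y = 0) : ∃ a : V, a • z = 0 ∧ ∃ k, y = a • k := by
  let a : Ideal V := LinearMap.ker (LinearMap.toSpanSingleton V E z)
  let T : (V ⧸ a) →ₗ[V] E := a.liftQ (LinearMap.toSpanSingleton V E z) le_rfl
  have hT : Function.Injective T := LinearMap.ker_eq_bot.1 (Submodule.ker_liftQ_eq_bot _ _ _ le_rfl)
  have h1 : (Ideal.Quotient.mk a 1) ⊗ₜ[V] y = 0 := by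
    apply Module.Flat.rTensor_preserves_injective_linearMap (M := K) T hT
    rw [LinearMap.rTensor_tmul, map_zero, ← h]
    congr 1
    exact one_smul V z
  have h2 : y ∈ (a • ⊤ : Submodule V K) := by
    have := congrArg (TensorProduct.quotTensorEquivQuotSMul K a) h1
    rw [TensorProduct.quotTensorEquivQuotSMul_mk_tmul, one_smul, map_zero] at this
    exact (Submodule.Quotient.mk_eq_zero _).1 this
  clear h1 h
  induction h2 using Submodule.smul_induction_on' with
  | smul b hb k _ => exact ⟨b, hb, k, rfl⟩
  | add x _ y _ hx hy =>
    obtain ⟨b, hb, k, rfl⟩ := hx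
    obtain ⟨c, hc, l, rfl⟩ := hy
    rcases ValuationRing.dvd_total b c with ⟨d, rfl⟩ | ⟨d, rfl⟩
    · exact ⟨b, hb, k + d • l, by rw [smul_add, smul_smul]⟩
    · exact ⟨c, hc, d • k + l, by rw [smul_add, smul_smul]⟩

/-- The image of a submodule `K` of `F` in `F / JF`, as a module over `R / J`. -/
def Submodule.imageQuotient {F : Type u} [AddCommGroup F] [Module R F] (K : Submodule R F)
    (J : Ideal R) : Submodule (R ⧸ J) (F ⧸ (J • ⊤ : Submodule R F)) where
  carrier := {x | ∃ k ∈ K, Submodule.Quotient.mk k = x}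
  zero_mem' := ⟨0, zero_mem _, rfl⟩
  add_mem' := by
    rintro _ _ ⟨k, hk, rfl⟩ ⟨l, hl, rfl⟩
    exact ⟨k + l, add_mem hk hl, rfl⟩
  smul_mem' := by
    rintro r _ ⟨k, hk, rfl⟩
    obtain ⟨r, rfl⟩ := Ideal.Quotient.mk_surjective r
    exact ⟨r • k, K.smul_mem r hk, rfl⟩

/-- K itself need not be flat, but its image in F/JF is torsion-free over the valuation domain R/J,
hence flat there. -/
theorem Ideal.exists_smul_sub_mem_of_tmul_eq_zero {J : Ideal R} [J.IsPrime]
    (hJ : ∀ a b : R, ∃ e, b - e * a ∈ J ∨ a - e * b ∈ J) {E : Type u} [AddCommGroup E]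
    [Module R E] (hE : Module.IsTorsionBySet R E J) {F : Type u} [AddCommGroup F] [Module R F]
    [Module.Flat R F] (K : Submodule R F) {z : E} {y : K} (h : z ⊗ₜ[R] y = 0) :
    ∃ a : R, a • z = 0 ∧ ∃ k ∈ K, (y : F) - a • k ∈ (J • ⊤ : Submodule R F) := by
  let _ : Module (R ⧸ J) E := hE.module
  have := ValuationRing.of_quotient_total hJ
  have := J.flat_quotient_smul_top F
  let K₀ := K.imageQuotient J
  have hflat : Module.Flat (R ⧸ J) K₀ := by
    rw [Module.Flat.flat_iff_torsion_eq_bot_of_isBezout, ← Submodule.isTorsionFree_iff_torsion_eq_bot]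
    infer_instance
  let q : K →+ K₀ :=
    { toFun := fun k => ⟨Submodule.Quotient.mk (k : F), k, k.2, rfl⟩
      map_zero' := rfl
      map_add' := fun _ _ => rfl }
  let B : E ⊗[R] K →+ E ⊗[R ⧸ J] K₀ :=
    TensorProduct.liftAddHom
      { toFun := fun e =>
          { toFun := fun k => e ⊗ₜ[R ⧸ J] q k
            map_zero' := by simp
            map_add' := fun _ _ => by simp [tmul_add] }
        map_zero' := by ext; simp
        map_add' := fun _ _ => by ext; simp [add_tmul] }
      (fun r e k => TensorProduct.smul_tmul (R := R ⧸ J) (Ideal.Quotient.mk J r) e (q k))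
  have h1 : z ⊗ₜ[R ⧸ J] q y = 0 := by
    have := congrArg B h
    rwa [map_zero] at this
  obtain ⟨a, ha, ⟨_, k, hk, rfl⟩, hak⟩ := ValuationRing.mem_annihilator_smul_of_tmul_eq_zero h1
  obtain ⟨a, rfl⟩ := Ideal.Quotient.mk_surjective a
  exact ⟨a, ha, k, hk, (Submodule.Quotient.eq _).1 (congrArg Subtype.val hak)⟩

/-- A sequence of elements `z n` of an ideal `E ≤ J`, where `R / J` is a valuation ring and `E` is
a retract of `J` annihilated by `J`, such that `c * z (n + 1) = z n`, `c * z 0 = 0`, `z 0 ≠ 0`. -/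
structure TorsionTower (J E : Ideal R) (c : R) (z : ℕ → R) : Prop where
  total : ∀ a b : R, ∃ e, b - e * a ∈ J ∨ a - e * b ∈ J
  le : E ≤ J
  mul_eq_zero : ∀ e ∈ E, ∀ j ∈ J, j * e = 0
  retract : ∃ ρ : J →ₗ[R] E, ∀ e (he : e ∈ E), ρ ⟨e, le he⟩ = ⟨e, he⟩
  mem : ∀ n, z n ∈ E
  mul_succ : ∀ n, c * z (n + 1) = z n
  mul_zero' : c * z 0 = 0
  ne_zero : z 0 ≠ 0

namespace TorsionTower

variable {J E : Ideal R} {c : R} {z : ℕ → R}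

theorem pow_mul_add (h : TorsionTower J E c z) (n m : ℕ) : c ^ n * z (n + m) = z m := by
  induction n with
  | zero => simp
  | succ n ih => rw [pow_succ, mul_assoc, show n + 1 + m = n + m + 1 by omega, h.mul_succ, ih]

theorem pow_mul_self (h : TorsionTower J E c z) (n : ℕ) : c ^ n * z n = z 0 :=
  h.pow_mul_add n 0

theorem pow_succ_mul (h : TorsionTower J E c z) (n : ℕ) : c ^ (n + 1) * z n = 0 := by
  rw [pow_succ', mul_assoc, h.pow_mul_self, h.mul_zero']

theorem pow_notMem (h : TorsionTower J E c z) (n : ℕ) : c ^ n ∉ J := fun hn =>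
  h.ne_zero (by rw [← h.pow_mul_self n, h.mul_eq_zero _ (h.mem n) _ hn])

theorem smul_eq_zero (h : TorsionTower J E c z) (n : ℕ) {F : Type u} [AddCommGroup F] [Module R F]
    {x : F} (hx : x ∈ (J • ⊤ : Submodule R F)) : z n • x = 0 := by
  induction hx using Submodule.smul_induction_on' with
  | smul a ha m _ => rw [smul_smul, mul_comm, h.mul_eq_zero _ (h.mem n) _ ha, zero_smul]
  | add x _ y _ hx hy => rw [smul_add, hx, hy, add_zero]

/-- `X / JX` has an element annihilated by a power of `c`, but not by `c ^ j`. -/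
def HasTorsion (J : Ideal R) (c : R) (j : ℕ) (X : Type u) [AddCommGroup X] [Module R X] : Prop :=
  ∃ ξ : X, c ^ j • ξ ∉ (J • ⊤ : Submodule R X) ∧ ∃ N, c ^ N • ξ ∈ (J • ⊤ : Submodule R X)

theorem hasTorsion_ker_ker [J.IsPrime] (h : TorsionTower J E c z) {j : ℕ} {X F F' : Type u}
    [AddCommGroup X] [Module R X] [AddCommGroup F] [Module R F] [AddCommGroup F'] [Module R F']
    [Module.Flat R F] [Module.Flat R F'] {f : F →ₗ[R] X} (hf : Function.Surjective f)
    {g : F' →ₗ[R] LinearMap.ker f} (hg : Function.Surjective g)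
    (hX : HasTorsion J c (j + 1) X) : HasTorsion J c j (LinearMap.ker g) := by
  obtain ⟨ξ, hξ, N, hN⟩ := hX
  obtain ⟨x, rfl⟩ := hf ξ
  have hmap : ∀ w ∈ (J • ⊤ : Submodule R F), f w ∈ (J • ⊤ : Submodule R X) := by
    intro w hw
    have := Submodule.mem_map_of_mem (f := f) hw
    rw [Submodule.map_smul''] at this
    exact Submodule.smul_mono le_rfl le_top this
  have hle : j + 1 < N := by
    by_contra! hle
    apply hξ
    rw [← Nat.sub_add_cancel hle, pow_add, mul_smul]
    exact Submodule.smul_mem _ _ hN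
  obtain ⟨q, hq, hfq⟩ : ∃ q ∈ (J • ⊤ : Submodule R F), f q = c ^ N • f x := by
    have : (J • ⊤ : Submodule R X) = Submodule.map f (J • ⊤) := by
      rw [Submodule.map_smul'', Submodule.map_top, LinearMap.range_eq_top.2 hf]
    rw [this] at hN
    exact hN
  have hy : c ^ N • x - q ∈ LinearMap.ker f := by simp [hfq]
  obtain ⟨y', hy'⟩ := hg ⟨_, hy⟩
  -- The index j + p = N - 1 is chosen so that c^N kills z (j + p), whence z (j + p) • y' is a
  -- second syzygy, while c^j sends z (j + p) to z p.
  obtain ⟨p, rfl⟩ : ∃ p, N = j + p + 1 := ⟨N - j - 1, by omega⟩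
  have hgz : z (j + p) • y' ∈ LinearMap.ker g := by
    rw [LinearMap.mem_ker, map_smul, hy']
    ext
    simp only [Submodule.coe_smul, smul_sub, h.smul_eq_zero _ hq, smul_smul, sub_zero]
    rw [mul_comm, h.pow_succ_mul, zero_smul]
    rfl
  refine ⟨⟨_, hgz⟩, fun hmem => ?_, j + p + 1, ?_⟩
  · obtain ⟨t, ht⟩ := J.exists_tensorSMul_eq hmem
    obtain ⟨ρ, hρ⟩ := h.retract
    have h1 : LinearMap.lTensor J (LinearMap.ker g).subtype t =
        (⟨z p, h.le (h.mem p)⟩ : J) ⊗ₜ y' := by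
      apply J.tensorSMul_injective F'
      rw [J.tensorSMul_lTensor, ht]
      simp [smul_smul, h.pow_mul_add]
    -- Apply ρ ⊗ g: it kills the image of J ⊗ ker g, and ρ fixes z p.
    have h2 : (⟨z p, h.mem p⟩ : E) ⊗ₜ[R] (⟨_, hy⟩ : LinearMap.ker f) = 0 := by
      have h3 : TensorProduct.map ρ g ∘ₗ LinearMap.lTensor J (LinearMap.ker g).subtype = 0 := by
        ext a k
        simp
      have h4 := LinearMap.congr_fun h3 t
      rwa [LinearMap.comp_apply, h1, map_tmul, hρ _ (h.mem p), hy'] at h4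
    obtain ⟨a, ha, k, hk, hak⟩ := Ideal.exists_smul_sub_mem_of_tmul_eq_zero h.total
      (fun e j => Subtype.ext (h.mul_eq_zero _ e.2 _ j.2)) (LinearMap.ker f) h2
    replace ha : a * z p = 0 := congrArg Subtype.val ha
    have hak' : c ^ (j + p + 1) • x - a • k ∈ (J • ⊤ : Submodule R F) := by
      have := add_mem hak hq
      convert this using 1
      simp only
      abel
    -- If a divided c^p modulo J, then z 0 = c^p z p would vanish. So c^p divides a modulo J, and
    -- cancelling c^p in F/JF contradicts the choice of ξ.
    obtain ⟨e, he | he⟩ := h.total a (c ^ p)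
    · apply h.ne_zero
      rw [← h.pow_mul_self p]
      linear_combination h.mul_eq_zero _ (h.mem p) _ he + e * ha
    · have h5 : c ^ (j + 1) • x - e • k ∈ (J • ⊤ : Submodule R F) := by
        apply J.mem_smul_top_of_smul_mem (h.pow_notMem p)
        have h6 : (a - e * c ^ p) • k ∈ (J • ⊤ : Submodule R F) :=
          Submodule.smul_mem_smul he trivial
        have := add_mem hak' h6
        convert this using 1
        rw [show j + p + 1 = p + (j + 1) by omega, pow_add]
        module
      apply hξ
      have := hmap _ h5
      rwa [map_sub, map_smul, map_smul, LinearMap.mem_ker.1 hk, smul_zero, sub_zero] at this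
  · have h0 : c ^ (j + p + 1) • (⟨_, hgz⟩ : LinearMap.ker g) = 0 := by
      ext
      simp only [Submodule.coe_smul, smul_smul, h.pow_succ_mul, zero_smul]
      rfl
    rw [h0]
    exact zero_mem _

theorem not_flatDimLE [J.IsPrime] (h : TorsionTower J E c z) (j : ℕ) (X : Type u)
    [AddCommGroup X] [Module R X] (hX : HasTorsion J c j X) : ¬ FlatDimLE R (2 * j) X := by
  induction j generalizing X with
  | zero =>
    intro hflat
    have : Module.Flat R X := hflat
    obtain ⟨ξ, hξ, N, hN⟩ := hX
    exact hξ (by simpa using J.mem_smul_top_of_smul_mem (h.pow_notMem N) hN)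
  | succ j ih =>
    rintro ⟨F, _, _, f, hF, hf, F', _, _, g, hF', hg, hd⟩
    exact ih _ (h.hasTorsion_ker_ker hf hg hX) hd

theorem wDim_eq_top [J.IsPrime] (h : TorsionTower J E c z) : wDim R = ⊤ := by
  refine wDim_eq_top_of_forall_not_flatDimLE E fun n hn => ?_
  have hbot : (J • ⊤ : Submodule R E) = ⊥ := by
    rw [eq_bot_iff, Submodule.smul_le]
    exact fun j hj e _ => Subtype.ext (h.mul_eq_zero _ e.2 _ hj)
  refine h.not_flatDimLE n E ⟨⟨z n, h.mem n⟩, ?_, n + 1, ?_⟩ (hn.mono (by omega))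
  · rw [hbot, Submodule.mem_bot]
    intro h0
    exact h.ne_zero (by rw [← h.pow_mul_self n]; exact congrArg Subtype.val h0)
  · rw [hbot, Submodule.mem_bot]
    exact Subtype.ext (h.pow_succ_mul n)

end TorsionTower

end Tower

/-! ### The amalgamated duplication along a square-zero ideal. -/

section Duplication

variable {A : Type u} [CommRing A]

/-- The diagonal embedding `A → A ⋈ I`. -/
def amalgDup.diag (I : Ideal A) : A →+* amalgDup I :=
  ((RingHom.id A).prod (RingHom.id A)).codRestrict (amalgDup I) fun a => by
    change a - a ∈ I
    simp

/-- The first projection `A ⋈ I → A`. -/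
def amalgDup.fst (I : Ideal A) : amalgDup I →+* A :=
  (RingHom.fst A A).comp (amalgDup I).subtype

/-- The element `(0, i)` of `A ⋈ I`. -/
def amalgDup.inr {I : Ideal A} (i : A) (hi : i ∈ I) : amalgDup I :=
  ⟨(0, i), show i - 0 ∈ I by simpa using hi⟩

theorem amalgDup.sub_mem {I : Ideal A} (x : amalgDup I) : (x : A × A).2 - (x : A × A).1 ∈ I := x.2

theorem amalgDup.exists_ringEquiv {I : Ideal A} (hI : ∀ i ∈ I, ∀ j ∈ I, i * j = 0) :
    ∃ e : amalgDup I ≃+* TrivSqZeroExt A I, ∀ x : amalgDup I,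
      (e x).fst = (x : A × A).1 ∧ ((e x).snd : A) = (x : A × A).2 - (x : A × A).1 := by
  refine ⟨
    { toFun := fun x => (TrivSqZeroExt.inl (x : A × A).1 +
        TrivSqZeroExt.inr ⟨(x : A × A).2 - (x : A × A).1, amalgDup.sub_mem x⟩ : TrivSqZeroExt A I)
      invFun := fun y => ⟨(y.fst, y.fst + y.snd), show y.fst + y.snd - y.fst ∈ I by simp⟩
      left_inv := fun x => by ext <;> simp
      right_inv := fun y => by ext <;> simp
      map_add' := fun x y => by
        ext
        · simp
        · simp; ring
      map_mul' := fun x y => by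
        ext
        · simp
        · have := hI _ (amalgDup.sub_mem x) _ (amalgDup.sub_mem y)
          simp
          linear_combination this }, fun x => by simp⟩

theorem amalgDup.isLocalRing [IsLocalRing A] {I : Ideal A} (hI : ∀ i ∈ I, ∀ j ∈ I, i * j = 0) :
    IsLocalRing (amalgDup I) := by
  have : IsLocalHom (amalgDup.fst I) := by
    refine ⟨fun x hx => ?_⟩
    obtain ⟨b, hb⟩ := hx.exists_right_inv
    replace hb : (x : A × A).1 * b = 1 := hb
    set i := (x : A × A).2 - (x : A × A).1 with hi
    have hi' : i ∈ I := amalgDup.sub_mem x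
    have hxi : (x : A × A).2 = (x : A × A).1 + i := by rw [hi]; ring
    refine IsUnit.of_mul_eq_one ⟨(b, b - b ^ 2 * i), ?_⟩ ?_
    · change b - b ^ 2 * i - b ∈ I
      rw [show b - b ^ 2 * i - b = -b ^ 2 * i by ring]
      exact I.mul_mem_left _ hi'
    · ext
      · exact hb
      · change (x : A × A).2 * (b - b ^ 2 * i) = 1
        rw [hxi]
        linear_combination (1 - b * i) * hb - b ^ 2 * hI i hi' i hi'
  exact RingHom.domain_isLocalRing (amalgDup.fst I)

/-- A local ring is its own localization at the maximal ideal. -/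
theorem IsArithmeticalRing.dvd_total [IsLocalRing A] (h : IsArithmeticalRing A) (x y : A) :
    x ∣ y ∨ y ∣ x := by
  let p := IsLocalRing.maximalIdeal A
  let L := Localization.AtPrime p
  have hunits : p.primeCompl ≤ IsUnit.submonoid A := fun a ha => by
    by_contra hn
    exact ha ((IsLocalRing.mem_maximalIdeal a).2 hn)
  have hbij : Function.Bijective (algebraMap A L) :=
    (IsLocalization.atUnits A p.primeCompl (S := L) hunits).bijective
  have key : ∀ x y : A, Ideal.span {algebraMap A L y} ≤ Ideal.span {algebraMap A L x} → x ∣ y := by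
    intro x y hxy
    obtain ⟨t, ht⟩ := Ideal.span_singleton_le_span_singleton.1 hxy
    obtain ⟨t, rfl⟩ := hbij.2 t
    exact ⟨t, hbij.1 (by rw [ht, map_mul])⟩
  exact ((h p _ _).imp (key y x) (key x y)).symm

theorem amalgDup.not_isArithmeticalRing [IsLocalRing A] {I : Ideal A}
    (hI : ∀ i ∈ I, ∀ j ∈ I, i * j = 0) (hne : I ≠ ⊥) : ¬ IsArithmeticalRing (amalgDup I) := by
  intro h
  have := amalgDup.isLocalRing hI
  obtain ⟨i, hi, hi0⟩ := Submodule.exists_mem_ne_zero_of_ne_bot hne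
  rcases h.dvd_total (inr i hi) (diag I i) with ⟨t, ht⟩ | ⟨t, ht⟩
  · have h1 : i = 0 * (t : A × A).1 := congrArg (fun x : amalgDup I => (x : A × A).1) ht
    exact hi0 (by simpa using h1)
  · have h1 : 0 = i * (t : A × A).1 := congrArg (fun x : amalgDup I => (x : A × A).1) ht
    have h2 : i = i * (t : A × A).2 := congrArg (fun x : amalgDup I => (x : A × A).2) ht
    exact hi0 (by linear_combination h2 - h1 + hI i hi _ (amalgDup.sub_mem t))

theorem Ideal.finitePresentation_span_range_iff {n : ℕ} (a : Fin n → A) :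
    Module.FinitePresentation A (Ideal.span (Set.range a)) ↔
      (LinearMap.ker (Fintype.linearCombination A a)).FG := by
  have h : LinearMap.range (Fintype.linearCombination A a) = Ideal.span (Set.range a) :=
    Fintype.range_linearCombination A a
  rw [← h, ← LinearMap.ker_rangeRestrict]
  have hs := LinearMap.surjective_rangeRestrict (Fintype.linearCombination A a)
  exact (Module.FinitePresentation.fg_ker_iff _ hs).symm

/-- The relations among the a i are exactly the images under π of those among the σ (a i), so finite
generation descends. -/
theorem IsCoherentRing.of_retract {R : Type u} [CommRing R] (h : IsCoherentRing R) (σ : A →+* R)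
    (π : R →+* A) (hπ : ∀ a, π (σ a) = a) : IsCoherentRing A := by
  intro J hJ
  obtain ⟨n, a, rfl⟩ := Submodule.fg_iff_exists_fin_generating_family.1 hJ
  have h1 := (Ideal.finitePresentation_span_range_iff (σ ∘ a)).1
    (h _ (Submodule.fg_span (Set.finite_range _)))
  refine (Ideal.finitePresentation_span_range_iff a).2 ?_
  have : RingHomSurjective π := ⟨fun x => ⟨σ x, hπ x⟩⟩
  let P : (Fin n → R) →ₛₗ[π] (Fin n → A) :=
    { toFun := fun v i => π (v i)
      map_add' := fun _ _ => by ext; simp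
      map_smul' := fun _ _ => by ext; simp }
  have h2 : Submodule.map P (LinearMap.ker (Fintype.linearCombination R (σ ∘ a))) =
      LinearMap.ker (Fintype.linearCombination A a) := by
    ext u
    constructor
    · rintro ⟨v, hv, rfl⟩
      have hv : ∑ i, v i * σ (a i) = 0 := hv
      have := congrArg π hv
      rw [map_sum, map_zero] at this
      simpa [Fintype.linearCombination_apply, P, hπ] using this
    · intro hu
      have hu : ∑ i, u i * a i = 0 := hu
      refine ⟨fun i => σ (u i), ?_, by ext i; exact hπ _⟩
      have := congrArg σ hu
      rw [map_sum, map_zero] at this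
      simpa [Fintype.linearCombination_apply] using this
  rw [← h2]
  exact h1.map P

/-- An ideal of square zero such that `aI = a²I` for all `a`. -/
structure IsSqDivisible (I : Ideal A) : Prop where
  mul_eq_zero : ∀ i ∈ I, ∀ j ∈ I, i * j = 0
  exists_eq : ∀ a : A, ∀ i ∈ I, ∃ j ∈ I, a * i = a ^ 2 * j

namespace IsSqDivisible

variable {I : Ideal A}

theorem of_span (h2 : I ^ 2 = ⊥)
    (h : ∀ a : A, Ideal.span {a} * I = Ideal.span {a ^ 2} * I) : IsSqDivisible I where
  mul_eq_zero i hi j hj := by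
    rw [sq] at h2
    simpa [h2] using Ideal.mul_mem_mul hi hj
  exists_eq a i hi := by
    have : a * i ∈ Ideal.span {a ^ 2} * I := by
      rw [← h]
      exact Ideal.mul_mem_mul (Ideal.mem_span_singleton_self a) hi
    obtain ⟨j, hj, hij⟩ := Ideal.mem_span_singleton_mul.1 this
    exact ⟨j, hj, hij.symm⟩

theorem isGaussianRing (hI : IsSqDivisible I) (h : IsSqTotal A) : IsGaussianRing (amalgDup I) := by
  obtain ⟨e, -⟩ := amalgDup.exists_ringEquiv hI.mul_eq_zero
  refine ((h.trivSqZeroExt fun a i => ?_).of_ringEquiv e).isGaussianRing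
  obtain ⟨j, hj, hij⟩ := hI.exists_eq a i i.2
  exact ⟨⟨j, hj⟩, Subtype.ext hij⟩

theorem mul_eq_zero_of_sq (hI : IsSqDivisible I) {n i : A} (hn : n ^ 2 = 0) (hi : i ∈ I) :
    n * i = 0 := by
  obtain ⟨j, -, hij⟩ := hI.exists_eq n i hi
  rw [hij, hn, zero_mul]

theorem exists_sub_mul_eq_zero (hI : IsSqDivisible I) (h : IsSqTotal A) (a b : A) :
    ∃ e, (∀ i ∈ I, (b - e * a) * i = 0) ∨ (∀ i ∈ I, (a - e * b) * i = 0) := by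
  rcases h.total a b with hab | hab
  · obtain ⟨r, n, rfl, -, hn⟩ := h.exists_eq_mul_add hab
    exact ⟨r, .inl fun i hi => by linear_combination hI.mul_eq_zero_of_sq hn hi⟩
  · obtain ⟨r, n, rfl, -, hn⟩ := h.exists_eq_mul_add hab
    exact ⟨r, .inr fun i hi => by linear_combination hI.mul_eq_zero_of_sq hn hi⟩

theorem mul_eq_zero_of_mul_eq_zero (hI : IsSqDivisible I) (h : IsSqTotal A) {a b : A}
    (hab : a * b = 0) : (∀ i ∈ I, a * i = 0) ∨ ∀ i ∈ I, b * i = 0 := by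
  rcases h.total a b with h1 | h1
  · exact .inr fun i hi => hI.mul_eq_zero_of_sq (h.sq_eq_zero a b hab h1.2) hi
  · exact .inl fun i hi =>
      hI.mul_eq_zero_of_sq (h.sq_eq_zero b a (by rw [mul_comm, hab]) h1.2) hi

theorem amalgDup_smul_eq_zero (hI : IsSqDivisible I) {x : amalgDup I}
    (hx : ∀ i ∈ I, (x : A × A).1 * i = 0) (ξ : zeroProd I) : x • ξ = 0 := by
  have h1 : ((ξ : amalgDup I) : A × A).1 = 0 := ξ.2
  have h2 := amalgDup.sub_mem (ξ : amalgDup I)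
  rw [h1, sub_zero] at h2
  refine Subtype.ext (Subtype.ext (Prod.ext ?_ ?_))
  · change (x : A × A).1 * ((ξ : amalgDup I) : A × A).1 = 0
    rw [h1, mul_zero]
  · change (x : A × A).2 * ((ξ : amalgDup I) : A × A).2 = 0
    linear_combination hx _ h2 + hI.mul_eq_zero _ (amalgDup.sub_mem x) _ h2

theorem amalgDup_smul_top_eq_bot (hI : IsSqDivisible I) {K : Ideal (amalgDup I)}
    (hK : ∀ x ∈ K, ∀ i ∈ I, (x : A × A).1 * i = 0) :
    (K • ⊤ : Submodule (amalgDup I) (zeroProd I)) = ⊥ := by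
  rw [eq_bot_iff, Submodule.smul_le]
  exact fun x hx ξ _ => hI.amalgDup_smul_eq_zero (hK x hx) ξ

/-- For ξ = (0, y) and r with rξ = 0, flatness gives ξ ∈ Ann(r)E. Taking r = (a, a) shows that
Ann(y) kills I; taking r = (0, y) then gives Ann(r)E = 0, so ξ = 0. -/
theorem not_flat (hI : IsSqDivisible I) (h : IsSqTotal A) (hne : I ≠ ⊥) :
    ¬ Module.Flat (amalgDup I) (zeroProd I) := by
  intro hflat
  obtain ⟨y, hy, hy0⟩ := Submodule.exists_mem_ne_zero_of_ne_bot hne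
  let ξ : zeroProd I := ⟨amalgDup.inr y hy, rfl⟩
  have hξ : ξ ≠ 0 := fun h0 =>
    hy0 (congrArg (fun x : zeroProd I => ((x : amalgDup I) : A × A).2) h0)
  have h1 : ∀ a : A, a * y = 0 → ∀ i ∈ I, a * i = 0 := by
    intro a hay
    by_contra hn
    have hmem := Module.Flat.mem_ker_mulRight_smul_top (y := amalgDup.diag I a) (ξ := ξ)
      (Subtype.ext (Subtype.ext (Prod.ext (mul_zero a) hay)))
    rw [hI.amalgDup_smul_top_eq_bot] at hmem
    · exact hξ hmem
    · intro x hx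
      have hxa : (x : A × A).1 * a = 0 :=
        congrArg (fun x : amalgDup I => (x : A × A).1) (LinearMap.mem_ker.1 hx)
      exact (hI.mul_eq_zero_of_mul_eq_zero h hxa).resolve_right hn
  have hmem := Module.Flat.mem_ker_mulRight_smul_top (y := amalgDup.inr y hy) (ξ := ξ)
    (Subtype.ext (Subtype.ext (Prod.ext (mul_zero _) (hI.mul_eq_zero y hy y hy))))
  rw [hI.amalgDup_smul_top_eq_bot] at hmem
  · exact hξ hmem
  · intro x hx
    have hxy : (x : A × A).2 * y = 0 :=
      congrArg (fun x : amalgDup I => (x : A × A).2) (LinearMap.mem_ker.1 hx)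
    exact h1 _ (by linear_combination hxy - hI.mul_eq_zero _ (amalgDup.sub_mem x) y hy)

theorem wDim_eq_top_of_sq_mul (hI : IsSqDivisible I) (h : IsSqTotal A) (hne : I ≠ ⊥)
    (hsq : ∀ c : A, ∀ i ∈ I, c ^ 2 * i = 0 → c * i = 0) : wDim (amalgDup I) = ⊤ := by
  obtain ⟨y, hy, hy0⟩ := Submodule.exists_mem_ne_zero_of_ne_bot hne
  let P : Ideal A := LinearMap.ker (LinearMap.mulRight A y)
  have hP : ∀ a, a ∈ P ↔ a * y = 0 := fun a => LinearMap.mem_ker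
  have key : ∀ a b e : A, (b - e * a) * y = 0 → a * b * y = 0 → b * y = 0 := by
    intro a b e hb hab
    have : (e * a) ^ 2 * y = 0 := by linear_combination e * hab - e * a * hb
    linear_combination hb + hsq _ y hy this
  have hprime : P.IsPrime := by
    refine ⟨fun h1 => hy0 ?_, fun {a b} hab => ?_⟩
    · have : (1 : A) ∈ P := h1 ▸ Submodule.mem_top
      simpa using (hP 1).1 this
    · simp only [hP] at hab ⊢
      obtain ⟨e, he | he⟩ := hI.exists_sub_mul_eq_zero h a b
      · exact .inr (key a b e (he y hy) hab)
      · exact .inl (key b a e (he y hy) (by rw [mul_comm b a, hab]))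
  let p : Ideal (amalgDup I) := P.comap (amalgDup.fst I)
  have hp : p.IsPrime := Ideal.comap_isPrime _ _
  -- The I-component of an element of p² is a sum of products from P·I, and total divisibility
  -- modulo Ann(I) merges it into one product.
  have hmul : ∀ x ∈ p * p, ∃ q ∈ P, ∃ e ∈ I, (x : A × A).2 - (x : A × A).1 = q * e := by
    have hadd : ∀ q₁ q₂ e₁ e₂ : A, q₁ ∈ P → q₂ ∈ P → e₁ ∈ I → e₂ ∈ I →
        ∃ q ∈ P, ∃ e ∈ I, q₁ * e₁ + q₂ * e₂ = q * e := by
      intro q₁ q₂ e₁ e₂ hq₁ hq₂ he₁ he₂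
      obtain ⟨r, hr | hr⟩ := hI.exists_sub_mul_eq_zero h q₁ q₂
      · exact ⟨q₁, hq₁, e₁ + r * e₂, I.add_mem he₁ (I.mul_mem_left r he₂), by
          linear_combination hr e₂ he₂⟩
      · exact ⟨q₂, hq₂, r * e₁ + e₂, I.add_mem (I.mul_mem_left r he₁) he₂, by
          linear_combination hr e₁ he₁⟩
    intro x hx
    induction hx using Submodule.mul_induction_on' with
    | mem_mul_mem x hx y hy =>
      obtain ⟨q, hq, e, he, hqe⟩ := hadd _ _ _ _ hx hy (amalgDup.sub_mem y) (amalgDup.sub_mem x)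
      refine ⟨q, hq, e, he, ?_⟩
      change (x : A × A).2 * (y : A × A).2 - (x : A × A).1 * (y : A × A).1 = q * e
      rw [← hqe]
      change _ = (x : A × A).1 * _ + (y : A × A).1 * _
      linear_combination hI.mul_eq_zero _ (amalgDup.sub_mem x) _ (amalgDup.sub_mem y)
    | add x _ y _ hx hy =>
      obtain ⟨q, hq, e, he, hqe⟩ := hx
      obtain ⟨r, hr, f, hf, hrf⟩ := hy
      obtain ⟨s, hs, g, hg, hsg⟩ := hadd _ _ _ _ hq hr he hf
      refine ⟨s, hs, g, hg, ?_⟩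
      change (x : A × A).2 + (y : A × A).2 - ((x : A × A).1 + (y : A × A).1) = s * g
      linear_combination hqe + hrf + hsg
  refine p.wDim_eq_top_of_sq_eq_zero (y := amalgDup.inr y hy) (show (0 : A) ∈ P from zero_mem P)
    (Subtype.ext (Prod.ext (mul_zero _) (hI.mul_eq_zero y hy y hy))) fun s hs hmem => hs ?_
  obtain ⟨q, hq, e, he, hqe⟩ := hmul _ hmem
  replace hqe : (s : A × A).2 * y - (s : A × A).1 * 0 = q * e := hqe
  change (s : A × A).1 ∈ P
  rw [hP] at hq ⊢
  -- From sy = qe and qy = 0 comes q²e = 0, so the hypothesis on squares gives qe = 0.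
  have h0 : q ^ 2 * e = 0 := by linear_combination (s : A × A).2 * hq - q * hqe
  linear_combination hqe + hsq q e he h0 - hI.mul_eq_zero _ (amalgDup.sub_mem s) y hy

theorem wDim_eq_top_of_sq_mul_eq_zero (hI : IsSqDivisible I) (h : IsSqTotal A) {c i : A}
    (hi : i ∈ I) (h2 : c ^ 2 * i = 0) (h1 : c * i ≠ 0) : wDim (amalgDup I) = ⊤ := by
  let N : Ideal A := Submodule.annihilator I
  have hN : ∀ a, a ∈ N ↔ ∀ i ∈ I, a * i = 0 := fun a => Submodule.mem_annihilator
  have key : ∀ a b e : A, (∀ i ∈ I, (b - e * a) * i = 0) → (∀ i ∈ I, a * b * i = 0) →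
      ∀ i ∈ I, b * i = 0 := by
    intro a b e hb hab i hi
    obtain ⟨j, hj, hij⟩ := hI.exists_eq a i hi
    linear_combination hb i hi + e * hij + hab j hj - a * hb j hj
  have hprime : N.IsPrime := by
    refine ⟨fun ht => h1 ?_, fun {a b} hab => ?_⟩
    · have : (1 : A) ∈ N := ht ▸ Submodule.mem_top
      have := (hN 1).1 this i hi
      rw [one_mul] at this
      rw [this, mul_zero]
    · simp only [hN] at hab ⊢
      obtain ⟨e, he | he⟩ := hI.exists_sub_mul_eq_zero h a b
      · exact .inr (key a b e he hab)
      · exact .inl (key b a e he (by simpa only [mul_comm b a] using hab))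
  let J : Ideal (amalgDup I) := N.comap (amalgDup.fst I)
  have hJ : J.IsPrime := Ideal.comap_isPrime _ _
  have hstep : ∀ w : {w : A // ∃ i ∈ I, w = c * i}, ∃ w' : {w : A // ∃ i ∈ I, w = c * i},
      c * w'.1 = w.1 := by
    rintro ⟨_, i, hi, rfl⟩
    obtain ⟨j, hj, hij⟩ := hI.exists_eq c i hi
    exact ⟨⟨c * j, j, hj, rfl⟩, by linear_combination -hij⟩
  choose s hs using hstep
  let w : ℕ → {w : A // ∃ i ∈ I, w = c * i} := fun n => s^[n] ⟨c * i, i, hi, rfl⟩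
  have hw : ∀ n, (w n).1 ∈ I := fun n => by
    obtain ⟨j, hj, hwj⟩ := (w n).2
    rw [hwj]
    exact I.mul_mem_left c hj
  have hle : zeroProd I ≤ J := fun x hx => by
    change (x : A × A).1 ∈ N
    rw [show (x : A × A).1 = 0 from hx]
    exact zero_mem N
  have htower : TorsionTower J (zeroProd I) (amalgDup.diag I c)
      (fun n => amalgDup.inr (w n).1 (hw n)) :=
    { total := fun x y => by
        obtain ⟨e, he⟩ := hI.exists_sub_mul_eq_zero h (x : A × A).1 (y : A × A).1
        exact ⟨amalgDup.diag I e, he.imp (hN _).2 (hN _).2⟩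
      le := hle
      mul_eq_zero := fun x hx y hy =>
        congrArg Subtype.val (hI.amalgDup_smul_eq_zero ((hN _).1 hy) ⟨x, hx⟩)
      -- The retraction (a, a + i) ↦ (0, i) is linear on J because first components of elements of J
      -- kill I.
      retract := ⟨
        { toFun := fun x => ⟨amalgDup.inr _ (amalgDup.sub_mem (x : amalgDup I)), rfl⟩
          map_add' := fun x y => by
            refine Subtype.ext (Subtype.ext (Prod.ext (add_zero _).symm ?_))
            change ((x : amalgDup I) : A × A).2 + ((y : amalgDup I) : A × A).2 -
              (((x : amalgDup I) : A × A).1 + ((y : amalgDup I) : A × A).1) = (_ - _) + (_ - _)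
            ring
          map_smul' := fun r x => by
            refine Subtype.ext (Subtype.ext (Prod.ext (mul_zero _).symm ?_))
            change (r : A × A).2 * ((x : amalgDup I) : A × A).2 -
              (r : A × A).1 * ((x : amalgDup I) : A × A).1 = (r : A × A).2 * (_ - _)
            have h0 : ((x : amalgDup I) : A × A).1 * ((r : A × A).2 - (r : A × A).1) = 0 :=
              (hN _).1 x.2 _ (amalgDup.sub_mem r)
            linear_combination h0 }, fun x hx => by
          have hx' : (x : A × A).1 = 0 := hx
          refine Subtype.ext (Subtype.ext (Prod.ext hx'.symm ?_))
          change (x : A × A).2 - (x : A × A).1 = _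
          rw [hx', sub_zero]⟩
      mem := fun n => rfl
      mul_succ := fun n => by
        refine Subtype.ext (Prod.ext (mul_zero _) ?_)
        change c * (w (n + 1)).1 = (w n).1
        simp only [w, Function.iterate_succ_apply', hs]
      mul_zero' := Subtype.ext (Prod.ext (mul_zero _) (by
        change c * (c * i) = 0
        linear_combination h2))
      ne_zero := fun h0 => h1 (congrArg (fun x : amalgDup I => (x : A × A).2) h0) }
  exact htower.wDim_eq_top

theorem wDim_eq_top (hI : IsSqDivisible I) (h : IsSqTotal A) (hne : I ≠ ⊥) :
    wDim (amalgDup I) = ⊤ := by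
  by_cases hsq : ∀ c : A, ∀ i ∈ I, c ^ 2 * i = 0 → c * i = 0
  · exact hI.wDim_eq_top_of_sq_mul h hne hsq
  · push Not at hsq
    obtain ⟨c, i, hi, h2, h1⟩ := hsq
    exact hI.wDim_eq_top_of_sq_mul_eq_zero h hi h2 h1

theorem amalgDup_properties [IsLocalRing A] (hI : IsSqDivisible I) (h : IsSqTotal A) (hne : I ≠ ⊥)
    (hcoh : ¬ IsCoherentRing A) :
    IsLocalRing (amalgDup I) ∧ ¬ IsArithmeticalRing (amalgDup I) ∧
      ¬ IsCoherentRing (amalgDup I) ∧ IsGaussianRing (amalgDup I) ∧ wDim (amalgDup I) = ⊤ :=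
  ⟨amalgDup.isLocalRing hI.mul_eq_zero, amalgDup.not_isArithmeticalRing hI.mul_eq_zero hne,
    fun hc => hcoh (hc.of_retract (amalgDup.diag I) (amalgDup.fst I) fun _ => rfl),
    hI.isGaussianRing h, hI.wDim_eq_top h hne⟩

end IsSqDivisible

end Duplication

/-! ### The ring ℤ₍₂₎ ⋉ ℚ. -/

section Example

theorem ValuationRing.isSqTotal (V : Type u) [CommRing V] [IsDomain V] [ValuationRing V] :
    IsSqTotal V where
  total a b := by
    have key : ∀ a b : V, a ∣ b → SqPrec a b := fun a b h =>
      ⟨by rw [sq]; exact mul_dvd_mul_left a h, pow_dvd_pow_of_dvd h 2⟩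
    exact (ValuationRing.dvd_total a b).imp (key a b) (key b a)
  sq_eq_zero a b hab hd := by
    rcases mul_eq_zero.1 hab with rfl | rfl
    · simpa using hd
    · simp

instance Z2.isLocalization_atPrime : IsLocalization.AtPrime Z2 (Ideal.span {(2 : ℤ)}) :=
  Localization.subalgebra.isLocalization_ofField ℚ _ _

theorem Z2.isDiscreteValuationRing : IsDiscreteValuationRing Z2 :=
  IsLocalization.AtPrime.isDiscreteValuationRing_of_dedekind_domain ℤ
    (P := Ideal.span {(2 : ℤ)}) (by simp) Z2

theorem Z2.not_isUnit_two : ¬ IsUnit (2 : Z2) := by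
  have h := IsLocalization.AtPrime.isUnit_to_map_iff Z2 (Ideal.span {(2 : ℤ)}) 2
  rw [map_ofNat] at h
  rw [h]
  exact fun hn => hn (Ideal.mem_span_singleton_self 2)

theorem Z2.exists_smul_eq {a : Z2} (ha : a ≠ 0) (q : ℚ) : ∃ r : ℚ, a • r = q := by
  have ha' : (a : ℚ) ≠ 0 := fun h => ha (Subtype.ext h)
  exact ⟨q / a, by
    change (a : ℚ) * (q / a) = q
    field_simp⟩

theorem Z2.exists_smul_eq_sq_smul (a : Z2) (q : ℚ) : ∃ r : ℚ, a • q = a ^ 2 • r := by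
  by_cases ha : a = 0
  · exact ⟨0, by simp [ha]⟩
  · obtain ⟨r, hr⟩ := Z2.exists_smul_eq (pow_ne_zero 2 ha) (a • q)
    exact ⟨r, hr.symm⟩

theorem Z2Q.isSqTotal : IsSqTotal Z2Q := by
  have := Z2.isDiscreteValuationRing
  exact (ValuationRing.isSqTotal Z2).trivSqZeroExt Z2.exists_smul_eq_sq_smul

theorem Z2Q.isLocalRing : IsLocalRing Z2Q := by
  have := Z2.isDiscreteValuationRing
  have : IsLocalHom (TrivSqZeroExt.fstHom Z2 Z2 ℚ).toRingHom :=
    ⟨fun x hx => TrivSqZeroExt.isUnit_iff_isUnit_fst.2 hx⟩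
  exact RingHom.domain_isLocalRing (TrivSqZeroExt.fstHom Z2 Z2 ℚ).toRingHom

theorem Z2Q.mem_zeroQ {x : Z2Q} : x ∈ zeroQ ↔ x.fst = 0 := RingHom.mem_ker

theorem Z2Q.inr_mem_zeroQ (q : ℚ) : (TrivSqZeroExt.inr q : Z2Q) ∈ zeroQ :=
  Z2Q.mem_zeroQ.2 (TrivSqZeroExt.fst_inr _ _)

theorem Z2Q.zeroQ_ne_bot : zeroQ ≠ ⊥ := fun h => by
  have h1 : (TrivSqZeroExt.inr 1 : Z2Q) ∈ (⊥ : Ideal Z2Q) := h ▸ Z2Q.inr_mem_zeroQ 1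
  have := congrArg TrivSqZeroExt.snd ((Submodule.mem_bot _).1 h1)
  simp at this

theorem Z2Q.zeroQ_ne_top : zeroQ ≠ ⊤ := RingHom.ker_ne_top _

theorem Z2Q.isSqDivisible : IsSqDivisible zeroQ where
  mul_eq_zero x hx y hy := by
    have := Ideal.mul_mem_mul hx hy
    rw [← sq, TrivSqZeroExt.kerIdeal_sq] at this
    exact this
  exists_eq a x hx := by
    obtain ⟨r, hr⟩ := Z2.exists_smul_eq_sq_smul a.fst x.snd
    refine ⟨TrivSqZeroExt.inr r, Z2Q.inr_mem_zeroQ r, ?_⟩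
    rw [Z2Q.mem_zeroQ] at hx
    ext
    · simp [hx]
    · simp only [TrivSqZeroExt.snd_mul, hx, TrivSqZeroExt.snd_inr, TrivSqZeroExt.fst_inr,
        TrivSqZeroExt.fst_pow, MulOpposite.op_zero, zero_smul, add_zero, hr]

theorem Z2Q.span_mul_zeroQ (a : Z2Q) :
    Ideal.span {a} * zeroQ = Ideal.span {a ^ 2} * zeroQ := by
  apply le_antisymm
  · intro x hx
    obtain ⟨i, hi, rfl⟩ := Ideal.mem_span_singleton_mul.1 hx
    obtain ⟨j, hj, hij⟩ := Z2Q.isSqDivisible.exists_eq a i hi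
    exact Ideal.mem_span_singleton_mul.2 ⟨j, hj, hij.symm⟩
  · refine Ideal.mul_mono_left (Ideal.span_singleton_le_span_singleton.2 ?_)
    exact Dvd.intro_left a (sq a).symm

/-- Nakayama: 2 is in the maximal ideal and ℚ = 2ℚ. -/
theorem Z2Q.not_fg_zeroQ : ¬ zeroQ.FG := by
  intro hfg
  have := Z2Q.isLocalRing
  have h2 : (2 : Z2Q) ∈ Ideal.jacobson ⊥ := by
    rw [IsLocalRing.jacobson_eq_maximalIdeal _ bot_ne_top, IsLocalRing.mem_maximalIdeal]
    intro hu
    apply Z2.not_isUnit_two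
    have := hu.map (TrivSqZeroExt.fstHom Z2 Z2 ℚ)
    rwa [map_ofNat] at this
  refine Z2Q.zeroQ_ne_bot (Submodule.eq_bot_of_le_smul_of_le_jacobson_bot (Ideal.span {2}) _ hfg ?_
    ((Ideal.span_singleton_le_iff_mem _).2 h2))
  intro x hx
  have h0 : (2 : Z2) ≠ 0 := two_ne_zero
  obtain ⟨r, hr⟩ := Z2.exists_smul_eq h0 x.snd
  have hxr : x = (2 : Z2Q) • (TrivSqZeroExt.inr r : Z2Q) := by
    rw [Z2Q.mem_zeroQ] at hx
    have h2 : (2 : Z2Q) = TrivSqZeroExt.inl (2 : Z2) := (map_ofNat (TrivSqZeroExt.inlHom Z2 ℚ) 2).symm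
    rw [h2, smul_eq_mul, TrivSqZeroExt.inl_mul_inr, hr]
    ext <;> simp [hx]
  rw [hxr]
  exact Submodule.smul_mem_smul (Ideal.mem_span_singleton_self _) (Z2Q.inr_mem_zeroQ r)

/-- The annihilator of (0, 1) is 0 ⋉ ℚ, so the principal ideal it generates is not finitely
presented. -/
theorem Z2Q.not_isCoherentRing : ¬ IsCoherentRing Z2Q := by
  intro h
  let e : Z2Q := TrivSqZeroExt.inr 1
  have := h (Ideal.span {e}) (Submodule.fg_span_singleton e)
  have h1 : LinearMap.range (LinearMap.toSpanSingleton Z2Q Z2Q e) = Ideal.span {e} :=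
    LinearMap.range_toSpanSingleton e
  rw [← h1] at this
  have h2 := Module.FinitePresentation.fg_ker _
    (LinearMap.surjective_rangeRestrict (LinearMap.toSpanSingleton Z2Q Z2Q e))
  rw [LinearMap.ker_rangeRestrict] at h2
  have h3 : LinearMap.ker (LinearMap.toSpanSingleton Z2Q Z2Q e) = zeroQ := by
    ext x
    rw [LinearMap.mem_ker, LinearMap.toSpanSingleton_apply, smul_eq_mul, Z2Q.mem_zeroQ]
    constructor
    · intro hx
      have h4 := congrArg TrivSqZeroExt.snd hx
      have h5 : x.fst • (1 : ℚ) = 0 := by simpa [e, TrivSqZeroExt.snd_mul] using h4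
      have h6 : (x.fst : ℚ) * 1 = 0 := h5
      exact Subtype.ext (by simpa using h6)
    · intro hx
      ext <;> simp [e, hx]
  exact Z2Q.not_fg_zeroQ (h3 ▸ h2)

theorem Z2Q.not_flat_zeroQ : ¬ Module.Flat Z2Q zeroQ := by
  intro hflat
  obtain ⟨e, he, he0⟩ := Submodule.exists_mem_ne_zero_of_ne_bot Z2Q.zeroQ_ne_bot
  have hmem := Module.Flat.mem_ker_mulRight_smul_top (y := (TrivSqZeroExt.inr 1 : Z2Q))
    (ξ := (⟨e, he⟩ : zeroQ))
    (Subtype.ext (Z2Q.isSqDivisible.mul_eq_zero _ (Z2Q.inr_mem_zeroQ 1) _ he))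
  have hbot : (LinearMap.ker (LinearMap.mulRight Z2Q (TrivSqZeroExt.inr 1 : Z2Q)) • ⊤ :
      Submodule Z2Q zeroQ) = ⊥ := by
    rw [eq_bot_iff, Submodule.smul_le]
    intro x hx y _
    have hx : x * TrivSqZeroExt.inr 1 = 0 := LinearMap.mem_ker.1 hx
    have h5 : x.fst • (1 : ℚ) = 0 := by
      simpa [TrivSqZeroExt.snd_mul] using congrArg TrivSqZeroExt.snd hx
    have h6 : (x.fst : ℚ) * 1 = 0 := h5
    refine Subtype.ext (Z2Q.isSqDivisible.mul_eq_zero x (Z2Q.mem_zeroQ.2 ?_) _ y.2)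
    exact Subtype.ext (by simpa using h6)
  rw [hbot] at hmem
  exact he0 (congrArg Subtype.val hmem)

end Example

theorem mainTheorem7 :
    (∀ (A : Type u) [CommRing A] [IsLocalRing A] (I : Ideal A),
      ¬ IsCoherentRing A → IsGaussianRing A → I ≠ ⊥ → I ≠ ⊤ → I ^ 2 = ⊥ →
      (∀ a : A, Ideal.span {a} * I = Ideal.span {a ^ 2} * I) →
      (∃ e : amalgDup I ≃+* TrivSqZeroExt A I, ∀ x : amalgDup I,
        (e x).fst = (x : A × A).1 ∧ ((e x).snd : A) = (x : A × A).2 - (x : A × A).1) ∧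
      ((I.FG ∨ ¬ Module.Flat A I) → ¬ Module.Flat (amalgDup I) (zeroProd I)) ∧
      (¬ Module.Flat (amalgDup I) (zeroProd I) →
        IsLocalRing (amalgDup I) ∧ ¬ IsArithmeticalRing (amalgDup I) ∧
        ¬ IsCoherentRing (amalgDup I) ∧ IsGaussianRing (amalgDup I) ∧
        wDim (amalgDup I) = ⊤)) ∧
    (IsLocalRing Z2Q ∧ ¬ IsCoherentRing Z2Q ∧ IsGaussianRing Z2Q ∧
      zeroQ ≠ ⊥ ∧ zeroQ ≠ ⊤ ∧ zeroQ ^ 2 = ⊥ ∧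
      (∀ a : Z2Q, Ideal.span {a} * zeroQ = Ideal.span {a ^ 2} * zeroQ) ∧
      ¬ Module.Flat Z2Q zeroQ ∧ ¬ Module.Flat (amalgDup zeroQ) (zeroProd zeroQ) ∧
      IsLocalRing (amalgDup zeroQ) ∧ ¬ IsArithmeticalRing (amalgDup zeroQ) ∧
      ¬ IsCoherentRing (amalgDup zeroQ) ∧ IsGaussianRing (amalgDup zeroQ) ∧
      wDim (amalgDup zeroQ) = ⊤) := by
  refine ⟨fun A _ _ I hcoh hG hbot _ h2 hdiv => ?_, ?_⟩
  · have hI := IsSqDivisible.of_span h2 hdiv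
    exact ⟨amalgDup.exists_ringEquiv hI.mul_eq_zero, fun _ => hI.not_flat hG.isSqTotal hbot,
      fun _ => hI.amalgDup_properties hG.isSqTotal hbot hcoh⟩
  · have := Z2Q.isLocalRing
    exact ⟨this, Z2Q.not_isCoherentRing, Z2Q.isSqTotal.isGaussianRing, Z2Q.zeroQ_ne_bot,
      Z2Q.zeroQ_ne_top, TrivSqZeroExt.kerIdeal_sq .., Z2Q.span_mul_zeroQ, Z2Q.not_flat_zeroQ,
      Z2Q.isSqDivisible.not_flat Z2Q.isSqTotal Z2Q.zeroQ_ne_bot,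
      Z2Q.isSqDivisible.amalgDup_properties Z2Q.isSqTotal Z2Q.zeroQ_ne_bot
        Z2Q.not_isCoherentRing⟩
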